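/- **Theorem (Existence and uniqueness: jump case).** Let $d\in\mathbb N$, $\mathbb H=\mathbb C^d$, and let $\mathcal S(\mathbb H)$ be the set of density matrices, i.e. of positive semidefinite self-adjoint $\rho\in\mathcal M_d(\mathbb C)$ with $\operatorname{tr}\rho=1$. Let * $\tilde H=\tilde H^\dagger\in\mathcal M_d(\mathbb C)$, let $L\in\mathcal M_d(\mathbb C)$ be unitary, and let $\rho_0\in\mathcal S(\mathbb H)$; * $a(x,y;x',y')$, $x,y,x',y'\in\{1,\dots,d\}$, be complex numbers with $a(x,y;x',y')=a(y,x;y',x')=\overline{a(x',y';x,y)}$, and put $A^{\rho}(x,x')=\sum_{y,y'=1}^{d}a(x,y;x',y')\,\overline{\rho(y,y')}$ for $\rho\in\mathcal M_d(\mathbb C)$; * $W:[0,1]^2\to[0,1]$ be a graphon, i.e. symmetric and measurable; * $(\Omega,\mathcal F,(\mathcal F_t)_{t\ge0},\mathbb P)$ be a filtered probability space and, for each $u\in[0,1]$, let $N^u$ be a Poisson process of intensity $1$ relative to $(\mathcal F_t)$: it is adapted, $N^u_0=0$, its paths are nondecreasing, right-continuous and $\mathbb N$-valued, and for $s\le t$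 the increment $N^u_t-N^u_s$ is independent of $\mathcal F_s$ and Poisson distributed with parameter $t-s$. (No assumption is made on the joint law of the family $(N^u)_u$.) Let $T>0$. A *solution on $[0,T]$* is a family $\gamma=(\gamma^u)_{u\in[0,1]}$ of adapted, $\mathcal M_d(\mathbb C)$-valued processes, each having almost surely càdlàg paths on $[0,T]$, such that $\sup_{u\in[0,1],\,t\le T}\mathbb E\|\gamma^u_t\|<\infty$, the map $v\mapsto\mathbb E[\gamma^v_{t-}]$ is integrable on $[0,1]$ for every $t\le T$ (where $\gamma_{0-}:=\gamma_0$), and, for every $u\in[0,1]$, almost surely the drift below is integrable on $[0,T]$ and for all $t\in[0,T]$ $$\gamma^u_t=\rho_0-\mathrm i\int_0^t\Big[\tilde H+\int_0^1 W(u,v)\,A^{\mathbb E[\gamma^v_{s-}]}\,\mathrm dv,\ \gamma^u_{s-}\Big]\mathrm ds+\int_{(0,t]}\big(L\gamma^u_{s-}L^\dagger-\gamma^u_{s-}\big)\,\mathrm dN^u_s .$$ Then: 1. (existence) there is a solution on $[0,T]$; 2. (uniqueness) if $\gamma$ and $\hat\gamma$ are two solutions on $[0,T]$, then for every $u\in[0,1]$,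 almost surely, $\gamma^u_t=\hat\gamma^u_t$ for all $t\in[0,T]$; 3. (state space) for every solution $\gamma$ on $[0,T]$ and every $u\in[0,1]$, almost surely, $\gamma^u_t\in\mathcal S(\mathbb H)$ for all $t\in[0,T]$. -/

import Mathlib

open MeasureTheory ProbabilityTheory Filter Topology
open scoped NNReal ENNReal ComplexOrder Matrix.Norms.L2Operator

/-- The density matrices on `ℂ^d`: positive semidefinite (in particular self-adjoint) matrices
of trace one. -/
def densityMatrices (d : ℕ) : Set (Matrix (Fin d) (Fin d) ℂ) :=
  {ρ | ρ.PosSemidef ∧ ρ.trace = 1}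

/-- A graphon: a symmetric measurable function on `[0,1]²` with values in `[0,1]`. -/
structure IsGraphon (W : unitInterval → unitInterval → ℝ) : Prop where
  measurable : Measurable (Function.uncurry W)
  symm : ∀ u v, W u v = W v u
  mem_Icc : ∀ u v, W u v ∈ Set.Icc (0 : ℝ) 1

/-- The kernel `a(x, y; x', y')` (written `a (x, y) (x', y')`) of a pair interaction: it is
invariant under the exchange of the two particles and it is self-adjoint. -/
structure IsPairInteraction {d : ℕ} (a : Matrix (Fin d × Fin d) (Fin d × Fin d) ℂ) : Prop where
  exchange : ∀ x y x' y', a (x, y) (x', y') = a (y, x) (y', x')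
  selfAdjoint : ∀ x y x' y', a (x, y) (x', y') = star (a (x', y') (x, y))

/-- The one-particle operator
`A^ρ(x, x') = ∑_{y, y'} a(x, y; x', y') * conj (ρ(y, y'))`. -/
def meanFieldOp {d : ℕ} (a : Matrix (Fin d × Fin d) (Fin d × Fin d) ℂ)
    (ρ : Matrix (Fin d) (Fin d) ℂ) : Matrix (Fin d) (Fin d) ℂ :=
  Matrix.of fun x x' => ∑ y, ∑ y', a (x, y) (x', y') * star (ρ y y')

/-- `N` is a Poisson process of unit intensity relative to the filtration `ℱ`: an adapted counting
process started at `0` whose increments `N t - N s` are Poisson of parameter `t - s` and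
independent of `ℱ s`. (The natural subtraction is exact since the paths are nondecreasing.) -/
structure IsUnitPoissonProcess {Ω : Type*} {mΩ : MeasurableSpace Ω} (P : Measure Ω)
    (ℱ : Filtration ℝ≥0 mΩ) (N : ℝ≥0 → Ω → ℕ) : Prop where
  adapted : ∀ t, Measurable[ℱ t] (N t)
  zero : ∀ ω, N 0 ω = 0
  monotone : ∀ ω, Monotone fun t => N t ω
  rightContinuous : ∀ ω t, ContinuousWithinAt (fun r => N r ω) (Set.Ici t) t
  law : ∀ s t, s ≤ t → HasLaw (fun ω => N t ω - N s ω) (poissonMeasure (t - s)) P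
  indep : ∀ s t, s ≤ t →
    Indep (MeasurableSpace.comap (fun ω => N t ω - N s ω) inferInstance) (ℱ s) P

/-- `f` is càdlàg on `[0,T]`. -/
def IsCadlagOn {E : Type*} [TopologicalSpace E] (T : ℝ≥0) (f : ℝ≥0 → E) : Prop :=
  ∀ t ≤ T, ContinuousWithinAt f (Set.Icc t T) t ∧ ∃ l, Tendsto f (𝓝[<] t) (𝓝 l)

/-- The integral `∫_{(0,t]} G_s dn_s` against a counting path `n` (nondecreasing, right-continuous
and `ℕ`-valued): the finite sum over the jump times `s ∈ (0,t]` of `(n_s - n_{s-}) G_s`. -/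
noncomputable def countingIntegral {d : ℕ} (n : ℝ≥0 → ℕ) (G : ℝ≥0 → Matrix (Fin d) (Fin d) ℂ)
    (t : ℝ≥0) : Matrix (Fin d) (Fin d) ℂ :=
  ∑ᶠ s ∈ Set.Ioc 0 t, ((n s : ℂ) - ((Function.leftLim n s : ℕ) : ℂ)) • G s

/-- The left limit `γ_{t-}(ω)` of a process. -/
noncomputable def leftProcess {d : ℕ} {Ω : Type*} (γ : ℝ≥0 → Ω → Matrix (Fin d) (Fin d) ℂ)
    (t : ℝ≥0) (ω : Ω) : Matrix (Fin d) (Fin d) ℂ :=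
  Function.leftLim (fun r => γ r ω) t

/-- The effective Hamiltonian `H̃ + ∫₀¹ W(u,v) A^{E[γ^v_{t-}]} dv` of the particle `u`. -/
noncomputable def effectiveHamiltonian {d : ℕ} {Ω : Type*} {mΩ : MeasurableSpace Ω}
    (P : Measure Ω) (H : Matrix (Fin d) (Fin d) ℂ)
    (a : Matrix (Fin d × Fin d) (Fin d × Fin d) ℂ) (W : unitInterval → unitInterval → ℝ)
    (γ : unitInterval → ℝ≥0 → Ω → Matrix (Fin d) (Fin d) ℂ) (u : unitInterval) (t : ℝ≥0) :
    Matrix (Fin d) (Fin d) ℂ :=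
  H + ∫ v : unitInterval, W u v • meanFieldOp a (∫ ω, leftProcess (γ v) t ω ∂P)

/-- The drift `-i [H̃ + ∫₀¹ W(u,v) A^{E[γ^v_{t-}]} dv, γ^u_{t-}]`. -/
noncomputable def jumpDrift {d : ℕ} {Ω : Type*} {mΩ : MeasurableSpace Ω}
    (P : Measure Ω) (H : Matrix (Fin d) (Fin d) ℂ)
    (a : Matrix (Fin d × Fin d) (Fin d × Fin d) ℂ) (W : unitInterval → unitInterval → ℝ)
    (γ : unitInterval → ℝ≥0 → Ω → Matrix (Fin d) (Fin d) ℂ) (u : unitInterval) (t : ℝ≥0)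
    (ω : Ω) : Matrix (Fin d) (Fin d) ℂ :=
  -Complex.I • (effectiveHamiltonian P H a W γ u t * leftProcess (γ u) t ω
    - leftProcess (γ u) t ω * effectiveHamiltonian P H a W γ u t)

/-- `γ = (γ^u)_{u ∈ [0,1]}` solves on `[0,T]` the photon-counting quantum graphon system
`dγ^u_t = -i [H̃ + ∫₀¹ W(u,v) A^{E[γ^v_{t-}]} dv, γ^u_{t-}] dt + (L γ^u_{t-} L† - γ^u_{t-}) dN^u_t`,
`γ^u_0 = ρ₀`. The matrices `γ^u_t` are not required to be density matrices; the fields `moment`,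
`mean_integrable` and `drift_integrable` say that all the integrals in the equation exist. -/
structure IsJumpGraphonSolution {d : ℕ} {Ω : Type*} {mΩ : MeasurableSpace Ω}
    (P : Measure Ω) (ℱ : Filtration ℝ≥0 mΩ) (N : unitInterval → ℝ≥0 → Ω → ℕ)
    (H L : Matrix (Fin d) (Fin d) ℂ) (a : Matrix (Fin d × Fin d) (Fin d × Fin d) ℂ)
    (W : unitInterval → unitInterval → ℝ) (ρ₀ : Matrix (Fin d) (Fin d) ℂ) (T : ℝ≥0)
    (γ : unitInterval → ℝ≥0 → Ω → Matrix (Fin d) (Fin d) ℂ) : Prop where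
  adapted : ∀ u, ∀ t ≤ T, StronglyMeasurable[ℱ t] (γ u t)
  cadlag : ∀ u, ∀ᵐ ω ∂P, IsCadlagOn T fun t => γ u t ω
  moment : ∃ C : ℝ≥0, ∀ u, ∀ t ≤ T, ∫⁻ ω, ‖γ u t ω‖ₑ ∂P ≤ C
  mean_integrable : ∀ t ≤ T, Integrable fun v : unitInterval => ∫ ω, leftProcess (γ v) t ω ∂P
  drift_integrable : ∀ u, ∀ᵐ ω ∂P,
    IntervalIntegrable (fun s : ℝ => jumpDrift P H a W γ u s.toNNReal ω) volume 0 T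
  equation : ∀ u, ∀ᵐ ω ∂P, ∀ t ≤ T,
    γ u t ω = ρ₀ + (∫ s in (0 : ℝ)..t, jumpDrift P H a W γ u s.toNNReal ω)
      + countingIntegral (fun s => N u s ω)
          (fun s => L * leftProcess (γ u) s ω * L.conjTranspose - leftProcess (γ u) s ω) t

/-! The interaction between particles enters only through the deterministic means `E[γ^v_{t-}]`.
Once these are prescribed as a family `m`, each particle obeys a linear equation with a
deterministic Hamiltonian, solved explicitly along every counting path. If `U` is the unitary
propagator of that Hamiltonian and `τ_j` are the jump times, the state is `V ρ₀ V*`, where `V` is `U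
t` times the ordered product of the factors `U(τ_j)* L U(τ_j)`. Since `L` is unitary, so is `V`;
positivity, unit trace and norm bounds are then immediate.

Existence becomes a fixed point problem for `m`, and the map sending `m` to the means of the
resulting paths contracts a supremum distance with weight `exp (l t)` (`exists_mean_fixedPoint`).
The contraction is pathwise: with the same jumps, `V* V'` is unchanged by a jump because `L* L = 1`,
so `‖V - V'‖` is at most the time integral of the difference of the Hamiltonians
(`norm_jumpFlow_sub_le`). The delicate point is that the means must be measurable in the label `v`,
although nothing relates the processes `N^v` to each other. The mean depends on `N^v` only through
its law: freezing the jump operators on a grid turns it into a limit of iterated Poisson averages,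
in which `N^v` no longer appears (`tendsto_meanStep`, `stronglyMeasurable_integral_jumpPath`). The
explicit path applies `L` once per jump counted with multiplicity, while the equation uses the left
limit at every jump; the two agree because jumps are almost surely simple (`ae_jumpTime_lt`).

Uniqueness concerns solutions not assumed to be states, so it rests on first moments. An increment
of `N^u` is independent of the past, so the mean of a jump sum is controlled by a time integral
(`exists_measurable_sum_jumps`). This gives a Gronwall estimate uniform in the label, whose
iteration forces `E‖γ^u_t - γ̂^u_t‖ = 0`; right-continuity makes the exceptional set independent of
`t`. The state space claim follows by comparing any solution with the constructed one. -/

/-! ### Counting paths, jump times and grids. -/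

/-- A counting path: a nondecreasing right-continuous `ℕ`-valued path started at `0`. -/
structure IsCountingPath (n : ℝ≥0 → ℕ) : Prop where
  zero : n 0 = 0
  monotone : Monotone n
  rightContinuous : ∀ t, ContinuousWithinAt n (Set.Ici t) t

/-- The time of the `j`-th jump (counted from `0`, with multiplicity) of a counting path. -/
noncomputable def jumpTime (n : ℝ≥0 → ℕ) (j : ℕ) : ℝ≥0 := sInf {s | j < n s}

/-- The last point strictly before `s` of the grid of mesh `δ`. -/
noncomputable def gridLeft (δ s : ℝ≥0) : ℝ≥0 := ((⌈s / δ⌉₊ - 1 : ℕ) : ℝ≥0) * δ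

lemma gridLeft_lt {δ s : ℝ≥0} (hδ : 0 < δ) (hs : 0 < s) : gridLeft δ s < s := by
  have h1 : 0 < ⌈s / δ⌉₊ := Nat.ceil_pos.2 (by positivity)
  have h2 : ((⌈s / δ⌉₊ - 1 : ℕ) : ℝ≥0) < s / δ := Nat.lt_ceil.1 (by omega)
  rwa [lt_div_iff₀ hδ] at h2

lemma le_gridLeft_add {δ : ℝ≥0} (hδ : 0 < δ) (s : ℝ≥0) : s ≤ gridLeft δ s + δ := by
  have h2 : s / δ ≤ ((⌈s / δ⌉₊ - 1 : ℕ) : ℝ≥0) + 1 := by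
    refine (Nat.le_ceil _).trans ?_
    norm_cast
    omega
  rw [div_le_iff₀ hδ] at h2
  unfold gridLeft
  linarith [h2, add_mul ((⌈s / δ⌉₊ - 1 : ℕ) : ℝ≥0) 1 δ, one_mul δ]

lemma gridLeft_eq {δ s : ℝ≥0} {k : ℕ} (h1 : (k : ℝ≥0) * δ < s) (h2 : s ≤ (k + 1 : ℕ) * δ) :
    gridLeft δ s = k * δ := by
  have hδ : 0 < δ := by
    rcases eq_or_lt_of_le (zero_le (a := δ)) with h | h
    · subst h; simp at h1 h2; exact absurd h1 (by simp [h2])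
    · exact h
  have : ⌈s / δ⌉₊ = k + 1 := by
    rw [Nat.ceil_eq_iff (by omega)]
    constructor
    · rw [lt_div_iff₀ hδ]; simpa using h1
    · rw [div_le_iff₀ hδ]; exact h2
  simp [gridLeft, this]

lemma tendsto_gridLeft {δ : ℕ → ℝ≥0} (hδ : ∀ n, 0 < δ n) (h0 : Tendsto δ atTop (𝓝 0)) {s : ℝ≥0}
    (hs : 0 < s) : Tendsto (fun n => gridLeft (δ n) s) atTop (𝓝[<] s) := by
  rw [tendsto_nhdsWithin_iff]
  refine ⟨?_, Eventually.of_forall fun n => gridLeft_lt (hδ n) hs⟩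
  have h1 : Tendsto (fun n => s - δ n) atTop (𝓝 s) := by
    simpa using tendsto_const_nhds.sub h0
  exact tendsto_of_tendsto_of_tendsto_of_le_of_le h1 tendsto_const_nhds
    (fun n => tsub_le_iff_right.2 (le_gridLeft_add (hδ n) s)) (fun n => (gridLeft_lt (hδ n) hs).le)

lemma tendsto_meshSize (t : ℝ≥0) :
    Tendsto (fun n : ℕ => t / ((n : ℝ≥0) + 1)) atTop (𝓝 0) := by
  have := (tendsto_one_div_add_atTop_nhds_zero_nat (𝕜 := ℝ≥0)).const_mul t
  simpa [div_eq_mul_inv] using this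

lemma meshSize_mul (t : ℝ≥0) (n : ℕ) : ((n + 1 : ℕ) : ℝ≥0) * (t / ((n : ℝ≥0) + 1)) = t := by
  push_cast
  field_simp

namespace IsCountingPath

variable {n : ℝ≥0 → ℕ} (hn : IsCountingPath n)
include hn

lemma eventually_eq_right (t : ℝ≥0) : ∀ᶠ r in 𝓝[≥] t, n r = n t := by
  have := hn.rightContinuous t
  rw [ContinuousWithinAt, nhds_discrete, tendsto_pure] at this
  exact this

lemma eventually_eq_left (t : ℝ≥0) : ∀ᶠ r in 𝓝[<] t, n r = Function.leftLim n t := by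
  have := hn.monotone.tendsto_leftLim t
  rw [nhds_discrete, tendsto_pure] at this
  exact this

lemma leftLim_zero : Function.leftLim n 0 = 0 := by
  rw [leftLim_eq_of_isBot (fun x => zero_le (a := x)), hn.zero]

/-- The infimum defining `jumpTime` is attained, because a right-continuous `ℕ`-valued path is
constant just after each time. The hypothesis `j < n t` excludes the infimum of the empty set. -/
lemma lt_iff_jumpTime_le {j : ℕ} {t : ℝ≥0} (hj : j < n t) (s : ℝ≥0) :
    j < n s ↔ jumpTime n j ≤ s := by
  have hb : BddBelow {s | j < n s} := OrderBot.bddBelow _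
  refine ⟨fun h => csInf_le hb h, fun h => ?_⟩
  refine lt_of_lt_of_le ?_ (hn.monotone h)
  by_contra hlt
  obtain ⟨b, hb1, hb2⟩ := (mem_nhdsGE_iff_exists_Ico_subset
    (α := ℝ≥0)).1 (hn.eventually_eq_right (jumpTime n j))
  refine absurd (le_csInf ⟨t, hj⟩ fun r hr => ?_) (not_le.2 (Set.mem_Ioi.1 hb1))
  by_contra hrb
  have : n r = n (jumpTime n j) := hb2 ⟨csInf_le hb hr, not_le.1 hrb⟩
  exact hlt (this ▸ hr)

lemma lt_jumpTime_iff {j : ℕ} {t : ℝ≥0} (hj : j < n t) (s : ℝ≥0) :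
    s < jumpTime n j ↔ n s ≤ j := by
  rw [← not_le, ← hn.lt_iff_jumpTime_le hj, not_lt]

lemma jumpTime_pos {j : ℕ} {t : ℝ≥0} (hj : j < n t) : 0 < jumpTime n j :=
  (hn.lt_jumpTime_iff hj 0).2 (by simp [hn.zero])

lemma lt_leftLim_iff {j : ℕ} {s : ℝ≥0} : j < Function.leftLim n s ↔ ∃ r < s, j < n r := by
  constructor
  · intro h
    rcases eq_or_lt_of_le (zero_le (a := s)) with rfl | hs
    · simp [hn.leftLim_zero] at h
    · have : (𝓝[<] s).NeBot := nhdsLT_neBot_of_exists_lt ⟨0, hs⟩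
      obtain ⟨r, hr, hrs⟩ := ((hn.eventually_eq_left s).and self_mem_nhdsWithin).exists
      exact ⟨r, hrs, hr ▸ h⟩
  · rintro ⟨r, hr, h⟩
    exact h.trans_le (hn.monotone.le_leftLim hr)

lemma lt_leftLim_iff_jumpTime_lt {j : ℕ} {t : ℝ≥0} (hj : j < n t) (s : ℝ≥0) :
    j < Function.leftLim n s ↔ jumpTime n j < s := by
  rw [hn.lt_leftLim_iff]
  constructor
  · rintro ⟨r, hr, h⟩
    exact ((hn.lt_iff_jumpTime_le hj r).1 h).trans_lt hr
  · intro h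
    exact ⟨_, h, (hn.lt_iff_jumpTime_le hj _).2 le_rfl⟩

lemma jumpTime_eq_iff {j : ℕ} {t : ℝ≥0} (hj : j < n t) (s : ℝ≥0) :
    jumpTime n j = s ↔ Function.leftLim n s ≤ j ∧ j < n s := by
  rw [hn.lt_iff_jumpTime_le hj, ← not_lt, hn.lt_leftLim_iff_jumpTime_lt hj, not_lt, and_comm,
    le_antisymm_iff]

/-- The integral against a counting path is the sum over its jump times. -/
lemma countingIntegral_eq_sum {d : ℕ} (G : ℝ≥0 → Matrix (Fin d) (Fin d) ℂ) (t : ℝ≥0) :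
    countingIntegral n G t = ∑ j ∈ Finset.range (n t), G (jumpTime n j) := by
  classical
  -- The indices jumping at `s` are exactly those `j` with `n_{s-} ≤ j < n_s`, so the fibre of
  -- `jumpTime n` over `s` has the size of the jump.
  have hcard : ∀ s ≤ t, ((Finset.range (n t)).filter fun j => jumpTime n j = s).card
      = n s - Function.leftLim n s := by
    intro s hs
    rw [← Nat.card_Ico]
    congr 1
    ext j
    simp only [Finset.mem_filter, Finset.mem_range, Finset.mem_Ico]
    constructor
    · rintro ⟨hj, h⟩
      exact (hn.jumpTime_eq_iff hj s).1 h
    · rintro h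
      have hj := h.2.trans_le (hn.monotone hs)
      exact ⟨hj, (hn.jumpTime_eq_iff hj s).2 h⟩
  have hcoef : ∀ s, ((n s : ℂ) - ((Function.leftLim n s : ℕ) : ℂ))
      = ((n s - Function.leftLim n s : ℕ) : ℂ) := fun s => by
    rw [Nat.cast_sub (hn.monotone.leftLim_le le_rfl)]
  unfold countingIntegral
  rw [finsum_mem_eq_sum_of_subset (t := (Finset.range (n t)).image (jumpTime n))]
  · rw [← Finset.sum_fiberwise_of_maps_to (g := jumpTime n)
      (t := (Finset.range (n t)).image (jumpTime n))
      (fun j hj => Finset.mem_image_of_mem _ hj)]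
    refine Finset.sum_congr rfl fun s hs => ?_
    obtain ⟨j, hj, rfl⟩ := Finset.mem_image.1 hs
    rw [Finset.sum_congr rfl (g := fun _ => G (jumpTime n j))
      (fun i hi => by rw [(Finset.mem_filter.1 hi).2]), Finset.sum_const, hcard _
        ((hn.lt_iff_jumpTime_le (Finset.mem_range.1 hj) _).1 (Finset.mem_range.1 hj)), hcoef,
      Nat.cast_smul_eq_nsmul]
  · rintro s ⟨hs, hsupp⟩
    have h0 : n s - Function.leftLim n s ≠ 0 := by
      intro h
      apply hsupp
      simp only [hcoef, h, Nat.cast_zero, zero_smul]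
    rw [← hcard s hs.2, Finset.card_ne_zero] at h0
    obtain ⟨j, hj⟩ := h0
    rw [Finset.mem_filter] at hj
    exact Finset.mem_coe.2 (Finset.mem_image.2 ⟨j, hj.1, hj.2⟩)
  · intro s hs
    obtain ⟨j, hj, rfl⟩ := Finset.mem_image.1 (Finset.mem_coe.1 hs)
    have hj := Finset.mem_range.1 hj
    exact ⟨hn.jumpTime_pos hj, (hn.lt_iff_jumpTime_le hj _).1 hj⟩

lemma gridLeft_jumpTime {δ : ℝ≥0} {j k : ℕ} (h1 : n (k * δ) ≤ j) (h2 : j < n ((k + 1 : ℕ) * δ)) :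
    gridLeft δ (jumpTime n j) = k * δ :=
  gridLeft_eq ((hn.lt_jumpTime_iff h2 _).2 h1) ((hn.lt_iff_jumpTime_le h2 _).1 h2)

lemma grid_mono (δ : ℝ≥0) (k : ℕ) : n (k * δ) ≤ n ((k + 1 : ℕ) * δ) :=
  hn.monotone (by gcongr; simp)

/-- A sum over the jumps with the integrand frozen on a grid is a Riemann-Stieltjes sum. -/
lemma sum_gridLeft {M : Type*} [AddCommMonoid M] (δ : ℝ≥0) (g : ℝ≥0 → M) (k : ℕ) :
    ∑ j ∈ Finset.range (n (k * δ)), g (gridLeft δ (jumpTime n j))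
      = ∑ i ∈ Finset.range k, (n ((i + 1 : ℕ) * δ) - n (i * δ)) • g (i * δ) := by
  induction k with
  | zero => simp [hn.zero]
  | succ k ih =>
    rw [Finset.sum_range_succ, ← ih, ← Finset.sum_range_add_sum_Ico _ (hn.grid_mono δ k)]
    congr 1
    rw [Finset.sum_congr rfl (g := fun _ => g (k * δ)), Finset.sum_const, Nat.card_Ico]
    intro j hj
    rw [hn.gridLeft_jumpTime (Finset.mem_Ico.1 hj).1 (Finset.mem_Ico.1 hj).2]

end IsCountingPath

/-! ### Ordered products. -/

/-- The ordered product `B (k-1) * ⋯ * B 0`. -/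
def orderedProd {A : Type*} [Monoid A] (B : ℕ → A) : ℕ → A
  | 0 => 1
  | k + 1 => B k * orderedProd B k

lemma orderedProd_add_of_const {A : Type*} [Monoid A] {B : ℕ → A} {b : A} {k m : ℕ}
    (h : ∀ j, k ≤ j → j < k + m → B j = b) : orderedProd B (k + m) = b ^ m * orderedProd B k := by
  induction m with
  | zero => simp
  | succ m ih =>
    rw [← add_assoc, orderedProd, ih fun j h1 h2 => h j h1 (by omega), h _ (by omega) (by omega),
      pow_succ', mul_assoc]

lemma tendsto_orderedProd {A : Type*} [Monoid A] [TopologicalSpace A] [ContinuousMul A]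
    {B : ℕ → ℕ → A} {B' : ℕ → A} {k : ℕ}
    (h : ∀ j < k, Tendsto (fun m => B m j) atTop (𝓝 (B' j))) :
    Tendsto (fun m => orderedProd (B m) k) atTop (𝓝 (orderedProd B' k)) := by
  induction k with
  | zero => exact tendsto_const_nhds
  | succ k ih => exact (h k (by omega)).mul (ih fun j hj => h j (by omega))

lemma orderedProd_mem {A : Type*} [Monoid A] {B : ℕ → A} {S : Submonoid A} (h : ∀ j, B j ∈ S)
    (k : ℕ) : orderedProd B k ∈ S := by
  induction k with
  | zero => exact S.one_mem
  | succ k ih => exact S.mul_mem (h k) ih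

/-- The ordered product over the jumps with the factors frozen on a grid. -/
lemma IsCountingPath.orderedProd_gridLeft {n : ℝ≥0 → ℕ} (hn : IsCountingPath n) {A : Type*}
    [Monoid A] (δ : ℝ≥0) (B : ℝ≥0 → A) (k : ℕ) :
    orderedProd (fun j => B (gridLeft δ (jumpTime n j))) (n ((k + 1 : ℕ) * δ))
      = B (k * δ) ^ (n ((k + 1 : ℕ) * δ) - n (k * δ))
        * orderedProd (fun j => B (gridLeft δ (jumpTime n j))) (n (k * δ)) := by
  have h := hn.grid_mono δ k
  conv_lhs => rw [← Nat.add_sub_cancel' h]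
  refine orderedProd_add_of_const fun j h1 h2 => ?_
  rw [hn.gridLeft_jumpTime h1 (by omega)]

lemma IsUnitPoissonProcess.isCountingPath {Ω : Type*} {mΩ : MeasurableSpace Ω} {P : Measure Ω}
    {ℱ : Filtration ℝ≥0 mΩ} {N : ℝ≥0 → Ω → ℕ} (hN : IsUnitPoissonProcess P ℱ N) (ω : Ω) :
    IsCountingPath fun t => N t ω :=
  ⟨hN.zero ω, hN.monotone ω, hN.rightContinuous ω⟩

/-! ### Weighted contractions and unitary propagators. -/

/-- Fixed points of maps which contract a weighted supremum distance. -/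
theorem exists_fixedPoint_of_weighted_contraction {ι E : Type*} [NormedAddCommGroup E]
    [CompleteSpace E] (w : ι → ℝ) (p : (ι → E) → Prop) (Φ : (ι → E) → ι → E)
    (hΦ : ∀ x, p x → p (Φ x))
    (hclosed : ∀ (x : ℕ → ι → E) (y : ι → E) (D : ℝ), (∀ n, p (x n)) →
      (∀ n i, ‖x n i - y i‖ ≤ D * (1 / 2) ^ n * w i) → p y)
    (hcontr : ∀ x y, p x → p y → ∀ D : ℝ, 0 ≤ D → (∀ i, ‖x i - y i‖ ≤ D * w i) →
      ∀ i, ‖Φ x i - Φ y i‖ ≤ D / 2 * w i)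
    (x₀ : ι → E) (hx₀ : p x₀) (D : ℝ) (hD : 0 ≤ D) (h₀ : ∀ i, ‖x₀ i - Φ x₀ i‖ ≤ D * w i) :
    ∃ x, p x ∧ Φ x = x := by
  -- The weighted distance may be infinite on `ι → E`, so Picard iteration is carried out
  -- coordinatewise from a point at finite distance from its image.
  set x : ℕ → ι → E := fun n => Φ^[n] x₀ with hx
  have hs : ∀ n, x (n + 1) = Φ (x n) := fun n => Function.iterate_succ_apply' Φ n x₀
  have hp : ∀ n, p (x n) := by
    intro n
    induction n with
    | zero => exact hx₀
    | succ n ih => rw [hs]; exact hΦ _ ih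
  have hd : ∀ n i, ‖x n i - x (n + 1) i‖ ≤ D * (1 / 2) ^ n * w i := by
    intro n
    induction n with
    | zero => intro i; simpa [hx] using h₀ i
    | succ n ih =>
      intro i
      rw [hs (n + 1)]
      nth_rewrite 1 [hs n]
      refine (hcontr _ _ (hp n) (hp (n + 1)) _ (by positivity) ih i).trans (le_of_eq ?_)
      ring
  have hd' : ∀ i n, dist (x n i) (x (n + 1) i) ≤ (D * w i) * (1 / 2) ^ n := fun i n => by
    rw [dist_eq_norm]; exact (hd n i).trans (le_of_eq (by ring))
  choose y hy using fun i =>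
    cauchySeq_tendsto_of_complete (cauchySeq_of_le_geometric _ _ (by norm_num) (hd' i))
  have hlim : ∀ n i, ‖x n i - y i‖ ≤ 2 * D * (1 / 2) ^ n * w i := fun n i => by
    rw [← dist_eq_norm]
    refine (dist_le_of_le_geometric_of_tendsto _ _ (by norm_num) (hd' i) (hy i) n).trans
      (le_of_eq (by ring))
  have hpy : p y := hclosed x y _ hp hlim
  refine ⟨y, hpy, funext fun i => ?_⟩
  refine tendsto_nhds_unique ?_ ((tendsto_add_atTop_iff_nat 1).2 (hy i))
  rw [tendsto_iff_norm_sub_tendsto_zero]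
  have hb : Tendsto (fun n : ℕ => 2 * D * (1 / 2 : ℝ) ^ n / 2 * w i) atTop (𝓝 0) := by
    have := ((tendsto_pow_atTop_nhds_zero_of_lt_one (r := (1 / 2 : ℝ)) (by norm_num)
      (by norm_num)).const_mul (2 * D)).div_const 2 |>.mul_const (w i)
    simpa using this
  refine squeeze_zero (fun _ => norm_nonneg _) (fun n => ?_) hb
  rw [hs]
  exact hcontr _ _ (hp n) hpy _ (by positivity) (hlim n) i

/-- A continuous weight is locally bounded, so weighted convergence is locally uniform. This makes
continuity a closed condition for the fixed point theorem. -/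
lemma continuous_of_weighted_approx {X E : Type*} [TopologicalSpace X] [NormedAddCommGroup E]
    {f : ℕ → X → E} {g : X → E} {w : X → ℝ} (hf : ∀ n, Continuous (f n)) (hw : Continuous w)
    (hw0 : ∀ t, 0 ≤ w t) {D : ℝ} (h : ∀ n t, ‖f n t - g t‖ ≤ D * (1 / 2) ^ n * w t) :
    Continuous g := by
  refine TendstoLocallyUniformly.continuous (F := f) (p := atTop) ?_
    (Frequently.of_forall hf)
  rw [Metric.tendstoLocallyUniformly_iff]
  intro ε hε t
  refine ⟨{s | w s < w t + 1}, (isOpen_lt hw continuous_const).mem_nhds (by simp), ?_⟩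
  have hb : Tendsto (fun n : ℕ => |D| * (1 / 2 : ℝ) ^ n * (w t + 1)) atTop (𝓝 0) := by
    have := ((tendsto_pow_atTop_nhds_zero_of_lt_one (r := (1 / 2 : ℝ)) (by norm_num)
      (by norm_num)).const_mul |D|).mul_const (w t + 1)
    simpa using this
  filter_upwards [hb.eventually (gt_mem_nhds hε)] with n hn s hs
  rw [dist_comm, dist_eq_norm]
  refine lt_of_le_of_lt (h n s) (lt_of_le_of_lt ?_ hn)
  have hs' : w s ≤ w t + 1 := le_of_lt hs
  gcongr
  · exact hw0 s
  · exact le_abs_self D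

lemma tendsto_of_weighted_approx {E : Type*} [NormedAddCommGroup E] {x : ℕ → E} {y : E}
    {D w : ℝ} (h : ∀ n, ‖x n - y‖ ≤ D * (1 / 2) ^ n * w) : Tendsto x atTop (𝓝 y) := by
  rw [tendsto_iff_norm_sub_tendsto_zero]
  refine squeeze_zero (fun _ => norm_nonneg _) h ?_
  have := ((tendsto_pow_atTop_nhds_zero_of_lt_one (r := (1 / 2 : ℝ)) (by norm_num)
      (by norm_num)).const_mul D).mul_const w
  simpa using this

lemma integral_exp_mul_le {c : ℝ} (hc : 0 < c) (t : ℝ) :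
    ∫ s in (0 : ℝ)..t, Real.exp (c * s) ≤ Real.exp (c * t) / c := by
  rw [intervalIntegral.integral_comp_mul_left (fun x => Real.exp x) hc.ne', integral_exp]
  rw [smul_eq_mul, inv_mul_eq_div, mul_zero, Real.exp_zero]
  gcongr
  linarith

lemma abs_integral_exp_mul_abs_le {c : ℝ} (hc : 0 < c) (t : ℝ) :
    |∫ s in (0 : ℝ)..t, Real.exp (c * |s|)| ≤ Real.exp (c * |t|) / c := by
  have key : ∀ t : ℝ, 0 ≤ t →
      |∫ s in (0 : ℝ)..t, Real.exp (c * |s|)| ≤ Real.exp (c * |t|) / c := by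
    intro t ht
    rw [abs_of_nonneg (intervalIntegral.integral_nonneg ht fun _ _ => (Real.exp_pos _).le)]
    rw [intervalIntegral.integral_congr (g := fun s => Real.exp (c * s)), abs_of_nonneg ht]
    · exact integral_exp_mul_le hc t
    · intro s hs
      rw [Set.uIcc_of_le ht] at hs
      simp [abs_of_nonneg hs.1]
  rcases le_total 0 t with ht | ht
  · exact key t ht
  · have := key (-t) (by linarith)
    have h2 := intervalIntegral.integral_comp_neg (a := 0) (b := t)
      (f := fun s => Real.exp (c * |s|))
    simp only [abs_neg, neg_zero] at h2
    rw [abs_neg] at this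
    rw [h2, intervalIntegral.integral_symm, abs_neg]
    exact this

lemma stronglyMeasurable_intervalIntegral_param {Λ E : Type*} [MeasurableSpace Λ]
    [NormedAddCommGroup E] [NormedSpace ℝ E] {f : Λ → ℝ → E}
    (hc : ∀ u, Continuous (f u)) (hm : ∀ t, StronglyMeasurable fun u => f u t) (a b : ℝ) :
    StronglyMeasurable fun u => ∫ s in a..b, f u s := by
  have h1 : StronglyMeasurable (Function.uncurry fun s u => f u s) :=
    stronglyMeasurable_uncurry_of_continuous_of_stronglyMeasurable hc hm
  have h2 : StronglyMeasurable (Function.uncurry f) := h1.comp_measurable measurable_swap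
  unfold intervalIntegral
  exact h2.integral_prod_right.sub h2.integral_prod_right

/-- Propagators of bounded continuous linear equations, depending measurably on a parameter. -/
theorem exists_propagator {Λ A : Type*} [MeasurableSpace Λ] [NormedRing A] [NormedAlgebra ℝ A]
    [CompleteSpace A] (c : Λ → ℝ → A) (hc : ∀ u, Continuous (c u))
    (hm : ∀ t, StronglyMeasurable fun u => c u t) {K : ℝ} (hK : ∀ u t, ‖c u t‖ ≤ K) :
    ∃ U : Λ → ℝ → A, (∀ u t, HasDerivAt (U u) (c u t * U u t) t) ∧ (∀ u, U u 0 = 1) ∧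
      ∀ t, StronglyMeasurable fun u => U u t := by
  rcases isEmpty_or_nonempty Λ with hΛ | ⟨⟨u₀⟩⟩
  · exact ⟨fun u => isEmptyElim u, fun u => isEmptyElim u, fun u => isEmptyElim u,
      fun t => by
        convert stronglyMeasurable_const (b := (0 : A)) using 1⟩
  have hK0 : 0 ≤ K := (norm_nonneg _).trans (hK u₀ 0)
  -- Chosen so that `K / l ≤ 1 / 2`, which is the contraction factor; the weight uses `|t|` because
  -- the equation is solved on all of `ℝ`.
  set l : ℝ := 2 * K + 1 with hl
  have hl0 : 0 < l := by positivity
  set Φ : (Λ × ℝ → A) → Λ × ℝ → A := fun x i => 1 + ∫ s in (0 : ℝ)..i.2, c i.1 s * x (i.1, s)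
  have hint : ∀ (x : Λ × ℝ → A) (u : Λ), (Continuous fun t => x (u, t)) →
      ∀ a b, IntervalIntegrable (fun s => c u s * x (u, s)) volume a b :=
    fun x u hx a b => ((hc u).mul hx).intervalIntegrable a b
  have hmain : ∃ x, ((∀ u, Continuous fun t => x (u, t)) ∧
      ∀ t, StronglyMeasurable fun u => x (u, t)) ∧ Φ x = x := by
    refine exists_fixedPoint_of_weighted_contraction
      (fun i : Λ × ℝ => Real.exp (l * |i.2|)) _ Φ ?_ ?_ ?_ (fun _ => 1)
      ⟨fun u => continuous_const, fun t => stronglyMeasurable_const⟩ 1 zero_le_one ?_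
    · rintro x ⟨h1, h2⟩
      refine ⟨fun u => ?_, fun t => ?_⟩
      · exact continuous_const.add (intervalIntegral.continuous_primitive (hint x u (h1 u)) 0)
      · exact stronglyMeasurable_const.add (stronglyMeasurable_intervalIntegral_param
          (f := fun u s => c u s * x (u, s)) (fun u => (hc u).mul (h1 u))
          (fun s => (hm s).mul (h2 s)) 0 t)
    · intro x y D hp h
      refine ⟨fun u => continuous_of_weighted_approx (f := fun n t => x n (u, t))
        (w := fun t => Real.exp (l * |t|)) (fun n => (hp n).1 u) (by fun_prop)
        (fun t => (Real.exp_pos _).le) (D := D) (fun n t => h n (u, t)), fun t => ?_⟩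
      exact stronglyMeasurable_of_tendsto atTop (fun n => (hp n).2 t)
        (tendsto_pi_nhds.2 fun u => tendsto_of_weighted_approx fun n => h n (u, t))
    · rintro x y ⟨hx, -⟩ ⟨hy, -⟩ D hD h ⟨u, t⟩
      have : Φ x (u, t) - Φ y (u, t) = ∫ s in (0 : ℝ)..t, c u s * (x (u, s) - y (u, s)) := by
        simp only [Φ, mul_sub, add_sub_add_left_eq_sub]
        rw [intervalIntegral.integral_sub (hint x u (hx u) 0 t) (hint y u (hy u) 0 t)]
      rw [this]
      have hb : ‖∫ s in (0 : ℝ)..t, c u s * (x (u, s) - y (u, s))‖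
          ≤ |∫ s in (0 : ℝ)..t, K * D * Real.exp (l * |s|)| := by
        refine intervalIntegral.norm_integral_le_abs_of_norm_le
          (Eventually.of_forall fun s => ?_) (Continuous.intervalIntegrable (by fun_prop) _ _)
        refine (norm_mul_le _ _).trans ?_
        rw [mul_assoc]
        exact mul_le_mul (hK u s) (h (u, s)) (norm_nonneg _) hK0
      refine hb.trans ?_
      rw [intervalIntegral.integral_const_mul, abs_mul, abs_of_nonneg (by positivity : 0 ≤ K * D)]
      refine (mul_le_mul_of_nonneg_left (abs_integral_exp_mul_abs_le hl0 t)
        (by positivity)).trans ?_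
      have : K / l ≤ 1 / 2 := by rw [div_le_div_iff₀ hl0 two_pos]; linarith
      calc K * D * (Real.exp (l * |t|) / l) = K / l * (D * Real.exp (l * |t|)) := by ring
        _ ≤ 1 / 2 * (D * Real.exp (l * |t|)) := by gcongr
        _ = _ := by ring
    · rintro ⟨u, t⟩
      simp only [Φ, sub_add_cancel_left, norm_neg, mul_one]
      have hb : ‖∫ s in (0 : ℝ)..t, c u s‖ ≤ K * |t| := by
        simpa using intervalIntegral.norm_integral_le_of_norm_le_const (a := 0) (b := t)
          (fun s _ => hK u s)
      rw [one_mul]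
      -- The starting distance is finite with constant `1`, since `K |t| ≤ l |t| ≤ exp (l |t|)`.
      have : |t| * K ≤ l * |t| := by nlinarith [abs_nonneg t]
      linarith [Real.add_one_le_exp (l * |t|), mul_comm K |t|]
  obtain ⟨x, ⟨hx1, hx2⟩, hfix⟩ := hmain
  have hfix' : ∀ u t, x (u, t) = 1 + ∫ s in (0 : ℝ)..t, c u s * x (u, s) := fun u t =>
    (congrFun hfix (u, t)).symm
  refine ⟨fun u t => x (u, t), fun u t => ?_, fun u => ?_, hx2⟩
  · have hcont := (hc u).mul (hx1 u)
    have := (intervalIntegral.integral_hasDerivAt_right (hint x u (hx1 u) 0 t)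
      (hcont.stronglyMeasurableAtFilter _ _) hcont.continuousAt).const_add (1 : A)
    exact this.congr_of_eventuallyEq (Eventually.of_forall (hfix' u))
  · simp [hfix' u 0]

/-- The propagator of a skew-adjoint equation is unitary. -/
lemma propagator_mem_unitary {A : Type*} [CStarAlgebra A] {c U : ℝ → A}
    (hU : ∀ t, HasDerivAt U (c t * U t) t) (h0 : U 0 = 1) (hc : ∀ t, star (c t) = -c t)
    (hfin : ∀ x y : A, x * y = 1 → y * x = 1) (t : ℝ) : U t ∈ unitary A := by
  -- Skew-adjointness makes `U* U` constant; `hfin` upgrades the resulting left inverse to a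
  -- two-sided one.
  have h1 : ∀ t, HasDerivAt (fun t => star (U t) * U t) 0 t := fun t => by
    have := (hU t).star.mul (hU t)
    have h2 : star (c t * U t) * U t + star (U t) * (c t * U t) = 0 := by
      rw [star_mul, hc]
      noncomm_ring
    rw [h2] at this
    exact this
  have h2 : star (U t) * U t = 1 := by
    have := is_const_of_deriv_eq_zero (fun t => (h1 t).differentiableAt) (fun t => (h1 t).deriv)
      t 0
    simpa [h0] using this
  exact ⟨h2, hfin _ _ h2⟩

/-! ### Poisson moments and simplicity of the jumps. -/

lemma lintegral_poissonMeasure (r : ℝ≥0) (f : ℕ → ℝ≥0∞) :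
    ∫⁻ k, f k ∂(poissonMeasure r)
      = ∑' k : ℕ, ENNReal.ofReal (Real.exp (-r) * r ^ k / k.factorial) * f k := by
  rw [poissonMeasure, lintegral_sum_measure]
  simp [lintegral_smul_measure, lintegral_dirac]

/-- The factorial moments of the Poisson distribution. -/
lemma lintegral_descFactorial_poissonMeasure (r : ℝ≥0) (m : ℕ) :
    ∫⁻ k, (k.descFactorial m : ℝ≥0∞) ∂(poissonMeasure r) = r ^ m := by
  have h1 : ∑' k : ℕ, ENNReal.ofReal (Real.exp (-r) * r ^ k / k.factorial) = 1 := by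
    have := lintegral_poissonMeasure r (fun _ => 1)
    simpa using this.symm
  -- Shifting the index by `m` cancels the falling factorial and leaves `r ^ m` times the Poisson
  -- weights; the first `m` terms of the series vanish.
  have hterm : ∀ k : ℕ, ENNReal.ofReal (Real.exp (-r) * r ^ (k + m) / (k + m).factorial)
      * ((k + m).descFactorial m : ℝ≥0∞)
      = r ^ m * ENNReal.ofReal (Real.exp (-r) * r ^ k / k.factorial) := by
    intro k
    have h2 : ((k + m).factorial : ℝ) = k.factorial * (k + m).descFactorial m := by
      have := Nat.factorial_mul_descFactorial (Nat.le_add_left m k)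
      rw [Nat.add_sub_cancel] at this
      exact_mod_cast this.symm
    have h3 : (0 : ℝ) < (k + m).descFactorial m := by
      exact_mod_cast Nat.descFactorial_pos.2 (Nat.le_add_left m k)
    have h4 : (0 : ℝ) < k.factorial := by exact_mod_cast k.factorial_pos
    rw [← ENNReal.ofReal_natCast ((k + m).descFactorial m), ← ENNReal.ofReal_mul (by positivity),
      ← ENNReal.ofReal_coe_nnreal, ← ENNReal.ofReal_pow r.coe_nonneg,
      ← ENNReal.ofReal_mul (by positivity)]
    congr 1
    rw [h2]
    field_simp
    ring
  rw [lintegral_poissonMeasure, ← (ENNReal.summable (f := _)).sum_add_tsum_nat_add' (k := m),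
    Finset.sum_eq_zero, zero_add]
  · simp_rw [hterm]
    rw [ENNReal.tsum_mul_left, h1, mul_one]
  · intro k hk
    rw [Nat.descFactorial_eq_zero_iff_lt.2 (Finset.mem_range.1 hk)]
    simp

namespace IsUnitPoissonProcess

variable {Ω : Type*} {mΩ : MeasurableSpace Ω} {P : Measure Ω} {ℱ : Filtration ℝ≥0 mΩ}
  {N : ℝ≥0 → Ω → ℕ} (hN : IsUnitPoissonProcess P ℱ N)
include hN

lemma measurable (t : ℝ≥0) : Measurable (N t) := (hN.adapted t).mono (ℱ.le t) le_rfl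

lemma lintegral_increment {s t : ℝ≥0} (hst : s ≤ t) :
    ∫⁻ ω, ((N t ω - N s ω : ℕ) : ℝ≥0∞) ∂P = ((t - s : ℝ≥0) : ℝ≥0∞) := by
  have := (hN.law s t hst).lintegral_comp (f := fun k : ℕ => (k : ℝ≥0∞))
    (measurable_of_countable _).aemeasurable
  rw [this]
  simpa using lintegral_descFactorial_poissonMeasure (t - s) 1

/-- Markov's inequality for the second factorial moment: `k (k - 1) ≥ 1` as soon as `k ≥ 2`. The
quadratic bound is what makes the union over grid cells negligible. -/
lemma measure_two_le_increment_le {s t : ℝ≥0} (hst : s ≤ t) :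
    P {ω | 2 ≤ N t ω - N s ω} ≤ ((t - s : ℝ≥0) : ℝ≥0∞) ^ 2 := by
  rw [(hN.law s t hst).measure_eq (p := fun k => 2 ≤ k) (MeasurableSet.of_discrete),
    ← lintegral_descFactorial_poissonMeasure, ← lintegral_indicator_one MeasurableSet.of_discrete]
  refine lintegral_mono fun k => ?_
  by_cases hk : 2 ≤ k
  · rw [Set.indicator_of_mem (by exact hk)]
    have : 1 ≤ k.descFactorial 2 := Nat.descFactorial_pos.2 hk
    exact (Nat.one_le_cast (α := ℝ≥0∞)).2 this
  · rw [Set.indicator_of_notMem (by exact hk)]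
    exact zero_le

/-- Almost surely all jumps before `T` are simple. -/
lemma ae_jumpTime_lt (T : ℝ≥0) :
    ∀ᵐ ω ∂P, ∀ j, j + 1 < N T ω → jumpTime (N · ω) j < jumpTime (N · ω) (j + 1) := by
  rw [ae_iff]
  set S := {ω | ¬∀ j, j + 1 < N T ω → jumpTime (N · ω) j < jumpTime (N · ω) (j + 1)} with hS
  have hbound : ∀ m : ℕ, P S ≤ ENNReal.ofReal (T * (T / (m + 1))) := by
    intro m
    set δ : ℝ≥0 := T / ((m : ℝ≥0) + 1) with hδ
    -- If jumps `j` and `j + 1` coincide, the first grid point beyond them closes a cell containing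
    -- both. Summing over `m + 1` cells costs `(m + 1) δ² = T² / (m + 1)`.
    have hsub : S ⊆ ⋃ i ∈ Finset.range (m + 1),
        {ω | 2 ≤ N ((i + 1 : ℕ) * δ) ω - N (i * δ) ω} := by
      intro ω hω
      simp only [hS, Set.mem_ofPred_eq, not_forall] at hω
      obtain ⟨j, hj, hlt⟩ := hω
      have hn := hN.isCountingPath ω
      have hT := meshSize_mul T m
      have hex : ∃ k : ℕ, j + 1 < N (k * δ) ω := ⟨m + 1, by rw [hT]; exact hj⟩
      classical
      set k := Nat.find hex with hk
      have hk1 : j + 1 < N (k * δ) ω := Nat.find_spec hex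
      have hk0 : k ≠ 0 := by
        intro h0
        rw [h0] at hk1
        simp [hN.zero ω] at hk1
      obtain ⟨i, hi⟩ := Nat.exists_eq_succ_of_ne_zero hk0
      have hkm : k ≤ m + 1 := Nat.find_min' hex (by rw [hT]; exact hj)
      have hi1 : N (i * δ) ω ≤ j + 1 := not_lt.1 (Nat.find_min hex (m := i) (by omega))
      rw [hi] at hk1
      have h1 := (hn.lt_jumpTime_iff hk1 (i * δ)).2 hi1
      have h2 := (hn.lt_jumpTime_iff (j := j) (Nat.lt_of_succ_lt hk1) (i * δ)).1
        (h1.trans_le (not_lt.1 hlt))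
      simp only [Set.mem_iUnion, Set.mem_ofPred_eq]
      refine ⟨i, Finset.mem_range.2 (by omega), ?_⟩
      have : j + 1 < N ((i + 1 : ℕ) * δ) ω := hk1
      have h2 : N (i * δ) ω ≤ j := h2
      omega
    refine (measure_mono hsub).trans ((measure_biUnion_finset_le _ _).trans ?_)
    have h1 : ∀ i ∈ Finset.range (m + 1), P {ω | 2 ≤ N ((i + 1 : ℕ) * δ) ω - N (i * δ) ω}
        ≤ (δ : ℝ≥0∞) ^ 2 := by
      intro i _
      refine (hN.measure_two_le_increment_le (by gcongr; simp)).trans (le_of_eq ?_)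
      congr 2
      push_cast
      rw [add_mul, one_mul, add_tsub_cancel_left]
    refine (Finset.sum_le_sum h1).trans (le_of_eq ?_)
    rw [Finset.sum_const, Finset.card_range, nsmul_eq_mul]
    have h2 : (T : ℝ) * (T / (m + 1)) = ((m + 1 : ℕ) : ℝ) * (δ : ℝ) ^ 2 := by
      rw [hδ]
      push_cast
      field_simp
    rw [h2, ENNReal.ofReal_mul (by positivity), ENNReal.ofReal_natCast,
      ENNReal.ofReal_pow δ.coe_nonneg, ENNReal.ofReal_coe_nnreal]
  have hlim : Tendsto (fun m : ℕ => ENNReal.ofReal (T * (T / (m + 1)))) atTop (𝓝 0) := by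
    rw [← ENNReal.ofReal_zero]
    refine ENNReal.tendsto_ofReal ?_
    have := (tendsto_one_div_add_atTop_nhds_zero_nat (𝕜 := ℝ)).const_mul ((T : ℝ) * T)
    rw [mul_zero] at this
    refine this.congr fun m => ?_
    ring
  exact le_antisymm (ge_of_tendsto' hlim hbound) zero_le

end IsUnitPoissonProcess

/-! ### Left limits of càdlàg processes and their first moments. -/

section LeftLimits

variable {E : Type*} [NormedAddCommGroup E]

lemma IsCadlagOn.tendsto_leftLim {T : ℝ≥0} {f : ℝ≥0 → E} (hf : IsCadlagOn T f) {s : ℝ≥0}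
    (hs : s ≤ T) : Tendsto f (𝓝[<] s) (𝓝 (Function.leftLim f s)) :=
  tendsto_leftLim_of_tendsto (hf s hs).2

/-- The grid points stay strictly below `s` while converging to it, so left limits are sequential
limits of values at grid times; measurability and Fatou arguments rely on this. -/
lemma IsCadlagOn.tendsto_gridLeft {T : ℝ≥0} {f : ℝ≥0 → E} (hf : IsCadlagOn T f) {δ : ℕ → ℝ≥0}
    (hδ : ∀ n, 0 < δ n) (h0 : Tendsto δ atTop (𝓝 0)) {s : ℝ≥0} (hs0 : 0 < s) (hs : s ≤ T) :
    Tendsto (fun n => f (gridLeft (δ n) s)) atTop (𝓝 (Function.leftLim f s)) :=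
  (hf.tendsto_leftLim hs).comp (_root_.tendsto_gridLeft hδ h0 hs0)

lemma IsCadlagOn.leftLim_sub {T : ℝ≥0} {f g : ℝ≥0 → E} (hf : IsCadlagOn T f)
    (hg : IsCadlagOn T g) {s : ℝ≥0} (hs : s ≤ T) :
    Function.leftLim (fun t => f t - g t) s = Function.leftLim f s - Function.leftLim g s := by
  rcases eq_or_lt_of_le (zero_le (a := s)) with rfl | hs0
  · have hb : IsBot (0 : ℝ≥0) := fun x => zero_le
    rw [leftLim_eq_of_isBot hb, leftLim_eq_of_isBot hb, leftLim_eq_of_isBot hb]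
  · have : (𝓝[<] s).NeBot := nhdsLT_neBot_of_exists_lt ⟨0, hs0⟩
    exact leftLim_eq_of_tendsto ((hf.tendsto_leftLim hs).sub (hg.tendsto_leftLim hs))

lemma IsCadlagOn.sub {T : ℝ≥0} {f g : ℝ≥0 → E} (hf : IsCadlagOn T f)
    (hg : IsCadlagOn T g) : IsCadlagOn T fun t => f t - g t := fun t ht =>
  ⟨(hf t ht).1.sub (hg t ht).1, _, (hf.tendsto_leftLim ht).sub (hg.tendsto_leftLim ht)⟩

end LeftLimits

section LeftLimitMoments

variable {Ω E : Type*} {mΩ : MeasurableSpace Ω} {P : Measure Ω} [NormedAddCommGroup E]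
  {ℱ : Filtration ℝ≥0 mΩ} {T : ℝ≥0} {X : ℝ≥0 → Ω → E}

/-- A jointly measurable version of the norm of the left limits of an adapted càdlàg process. -/
lemma exists_measurable_enorm_leftLim (hX : ∀ t ≤ T, StronglyMeasurable[ℱ t] (X t))
    (hc : ∀ᵐ ω ∂P, IsCadlagOn T fun t => X t ω) :
    ∃ G : Ω × ℝ → ℝ≥0∞, Measurable G ∧
      (∀ᵐ ω ∂P, ∀ s : ℝ, s ∈ Set.Ioc 0 (T : ℝ) →
        ‖Function.leftLim (fun r => X r ω) s.toNNReal‖ₑ = G (ω, s)) ∧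
      ∀ s : ℝ, s ∈ Set.Ioc 0 (T : ℝ) → ∀ b : ℝ≥0∞,
        (∀ r < s.toNNReal, ∫⁻ ω, ‖X r ω‖ₑ ∂P ≤ b) → ∫⁻ ω, G (ω, s) ∂P ≤ b := by
  set δ : ℕ → ℝ≥0 := fun n => 1 / ((n : ℝ≥0) + 1) with hδ
  have hδ0 : ∀ n, 0 < δ n := fun n => by positivity
  have hδl : Tendsto δ atTop (𝓝 0) := tendsto_meshSize 1
  have hXm : ∀ t ≤ T, Measurable fun ω => ‖X t ω‖ₑ := fun t ht =>
    ((hX t ht).mono (ℱ.le t)).enorm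
  -- Time enters only through the integer index of its grid cell, which yields joint measurability
  -- without any regularity of null paths. Truncation at `T` keeps the times where `X` is known to
  -- be measurable.
  set Y : ℕ → Ω × ℝ → ℝ≥0∞ := fun n q => ‖X (min (gridLeft (δ n) q.2.toNNReal) T) q.1‖ₑ with hY
  have hYm : ∀ n, Measurable (Y n) := by
    intro n
    have h1 : Measurable fun q : Ω × ℕ => ‖X (min (q.2 * δ n) T) q.1‖ₑ :=
      measurable_from_prod_countable_left fun k => hXm (min (k * δ n) T) (min_le_right _ _)
    have h2 : Measurable fun q : Ω × ℝ => (q.1, ⌈q.2.toNNReal / δ n⌉₊ - 1) :=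
      measurable_fst.prodMk ((measurable_of_countable fun k : ℕ => k - 1).comp
        (Nat.measurable_ceil.comp ((measurable_snd.real_toNNReal).div_const _)))
    have h3 : Y n = (fun q : Ω × ℕ => ‖X (min (q.2 * δ n) T) q.1‖ₑ) ∘
        fun q : Ω × ℝ => (q.1, ⌈q.2.toNNReal / δ n⌉₊ - 1) := by
      funext q
      simp only [hY, gridLeft, Function.comp]
    rw [h3]
    exact h1.comp h2
  have hpos : ∀ s : ℝ, s ∈ Set.Ioc 0 (T : ℝ) → 0 < s.toNNReal ∧ s.toNNReal ≤ T := fun s hs =>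
    ⟨Real.toNNReal_pos.2 hs.1, Real.toNNReal_le_iff_le_coe.2 hs.2⟩
  refine ⟨fun q => liminf (fun n => Y n q) atTop, Measurable.liminf hYm, ?_, ?_⟩
  · filter_upwards [hc] with ω hω s hs
    obtain ⟨h0, h1⟩ := hpos s hs
    have := (hω.tendsto_gridLeft hδ0 hδl h0 h1).enorm
    refine (Tendsto.liminf_eq (this.congr fun n => ?_)).symm
    simp only [hY]
    rw [min_eq_left ((gridLeft_lt (hδ0 n) h0).le.trans h1)]
  · intro s hs b hb
    obtain ⟨h0, h1⟩ := hpos s hs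
    -- Fatou's lemma: every approximant is the norm at a time strictly before `s`.
    refine (lintegral_liminf_le fun n => (hYm n).comp (measurable_id.prodMk
      measurable_const)).trans ?_
    refine liminf_le_of_le (h := fun a ha => ?_)
    obtain ⟨n, hn⟩ := ha.exists
    refine hn.trans (hb (min (gridLeft (δ n) s.toNNReal) T) ?_)
    exact (min_le_left _ _).trans_lt (gridLeft_lt (hδ0 n) h0)

/-- The norm of a left limit has no larger mean than the norms before it. -/
lemma lintegral_enorm_leftLim_le (hX : ∀ t ≤ T, StronglyMeasurable[ℱ t] (X t))
    (hc : ∀ᵐ ω ∂P, IsCadlagOn T fun t => X t ω) {t : ℝ≥0} (ht : t ≤ T) {b : ℝ≥0∞}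
    (hb : ∀ r ≤ t, ∫⁻ ω, ‖X r ω‖ₑ ∂P ≤ b) :
    ∫⁻ ω, ‖Function.leftLim (fun r => X r ω) t‖ₑ ∂P ≤ b := by
  rcases eq_or_lt_of_le (zero_le (a := t)) with rfl | ht0
  · simp_rw [fun ω => leftLim_eq_of_isBot (f := fun r => X r ω)
      (a := (0 : ℝ≥0)) (fun x => zero_le)]
    exact hb 0 le_rfl
  · obtain ⟨G, -, h1, h2⟩ := exists_measurable_enorm_leftLim hX hc
    have hm : (t : ℝ) ∈ Set.Ioc 0 (T : ℝ) := ⟨ht0, ht⟩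
    refine le_trans (lintegral_mono_ae ?_) (h2 t hm b fun r hr => hb r ?_)
    · filter_upwards [h1] with ω hω
      rw [← hω t hm, Real.toNNReal_coe]
    · rw [Real.toNNReal_coe] at hr
      exact hr.le

lemma aestronglyMeasurable_leftLim (hX : ∀ t ≤ T, StronglyMeasurable[ℱ t] (X t))
    (hc : ∀ᵐ ω ∂P, IsCadlagOn T fun t => X t ω) {t : ℝ≥0} (ht : t ≤ T) :
    AEStronglyMeasurable (fun ω => Function.leftLim (fun r => X r ω) t) P := by
  rcases eq_or_lt_of_le (zero_le (a := t)) with rfl | ht0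
  · simp_rw [fun ω => leftLim_eq_of_isBot (f := fun r => X r ω)
      (a := (0 : ℝ≥0)) (fun x => zero_le)]
    exact ((hX 0 ht).mono (ℱ.le 0)).aestronglyMeasurable
  · have hδ0 : ∀ n : ℕ, 0 < (1 : ℝ≥0) / ((n : ℝ≥0) + 1) := fun n => by positivity
    refine aestronglyMeasurable_of_tendsto_ae atTop (fun n : ℕ =>
      ((hX (gridLeft (1 / ((n : ℝ≥0) + 1)) t) ?_).mono (ℱ.le _)).aestronglyMeasurable) ?_
    · exact (gridLeft_lt (hδ0 n) ht0).le.trans ht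
    · filter_upwards [hc] with ω hω
      exact hω.tendsto_gridLeft hδ0 (tendsto_meshSize 1) ht0 ht

/-- A left Riemann sum of a monotone function lies below its integral. -/
lemma sum_mul_mesh_le_lintegral {ψ : ℝ≥0 → ℝ≥0∞} (hψ : Monotone ψ) (δ : ℝ≥0) (k : ℕ) :
    ∑ i ∈ Finset.range k, δ * ψ (i * δ)
      ≤ ∫⁻ s in Set.Ioc (0 : ℝ) ((k * δ : ℝ≥0) : ℝ), ψ s.toNNReal := by
  induction k with
  | zero => simp
  | succ k ih =>
    have h1 : ((k * δ : ℝ≥0) : ℝ) ≤ (((k + 1 : ℕ) * δ : ℝ≥0) : ℝ) := by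
      norm_cast; gcongr; simp
    rw [Finset.sum_range_succ, ← Set.Ioc_union_Ioc_eq_Ioc (NNReal.coe_nonneg _) h1,
      lintegral_union measurableSet_Ioc (Set.Ioc_disjoint_Ioc_of_le le_rfl)]
    refine add_le_add ih ?_
    have h2 : ∫⁻ _ in Set.Ioc ((k * δ : ℝ≥0) : ℝ) (((k + 1 : ℕ) * δ : ℝ≥0) : ℝ), ψ (k * δ)
        = δ * ψ (k * δ) := by
      rw [setLIntegral_const, Real.volume_Ioc, mul_comm]
      congr 1
      rw [← ENNReal.ofReal_coe_nnreal]
      congr 1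
      push_cast
      ring
    rw [← h2]
    refine setLIntegral_mono' measurableSet_Ioc fun s hs => hψ ?_
    exact NNReal.coe_le_coe.1 (hs.1.le.trans (Real.le_coe_toNNReal s))

/-- The mean of the sum of the left limits at the jumps of a Poisson process is at most the
time integral of any monotone bound of the means. -/
lemma exists_measurable_sum_jumps {N : ℝ≥0 → Ω → ℕ} (hN : IsUnitPoissonProcess P ℱ N)
    (hX : ∀ t ≤ T, StronglyMeasurable[ℱ t] (X t))
    (hc : ∀ᵐ ω ∂P, IsCadlagOn T fun t => X t ω) {ψ : ℝ≥0 → ℝ≥0∞} (hψ : Monotone ψ)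
    (hb : ∀ t ≤ T, ∫⁻ ω, ‖X t ω‖ₑ ∂P ≤ ψ t) {t : ℝ≥0} (ht : t ≤ T) :
    ∃ F : Ω → ℝ≥0∞, Measurable F ∧
      (∀ᵐ ω ∂P, ∑ j ∈ Finset.range (N t ω),
        ‖Function.leftLim (fun r => X r ω) (jumpTime (N · ω) j)‖ₑ = F ω) ∧
      ∫⁻ ω, F ω ∂P ≤ ∫⁻ s in Set.Ioc (0 : ℝ) t, ψ s.toNNReal := by
  rcases eq_or_lt_of_le (zero_le (a := t)) with rfl | ht0
  · exact ⟨fun _ => 0, measurable_const, Eventually.of_forall fun ω => by simp [hN.zero ω],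
      by simp⟩
  set δ : ℕ → ℝ≥0 := fun n => t / ((n : ℝ≥0) + 1) with hδ
  have hδ0 : ∀ n, 0 < δ n := fun n => by positivity
  have hδl : Tendsto δ atTop (𝓝 0) := tendsto_meshSize t
  have hδt : ∀ n, ((n + 1 : ℕ) : ℝ≥0) * δ n = t := fun n => meshSize_mul t n
  have hgrid : ∀ n i : ℕ, i < n + 1 → (i : ℝ≥0) * δ n ≤ t := fun n i hi => by
    rw [← hδt n]; gcongr
  -- Riemann-Stieltjes sums with the integrand taken at the left end of each cell; they converge to
  -- the sum of left limits at the jumps.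
  set Y : ℕ → Ω → ℝ≥0∞ := fun n ω => ∑ i ∈ Finset.range (n + 1),
    ((N ((i + 1 : ℕ) * δ n) ω - N (i * δ n) ω : ℕ) : ℝ≥0∞) * ‖X (i * δ n) ω‖ₑ with hY
  have hXm : ∀ t ≤ T, Measurable[ℱ t] fun ω => ‖X t ω‖ₑ := fun t ht => (hX t ht).enorm
  have hNm : ∀ n i, Measurable fun ω =>
      ((N ((i + 1 : ℕ) * δ n) ω - N (i * δ n) ω : ℕ) : ℝ≥0∞) := fun n i =>
    (measurable_of_countable fun k : ℕ => (k : ℝ≥0∞)).comp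
      ((hN.measurable _).sub (hN.measurable _))
  have hYm : ∀ n, Measurable (Y n) := fun n => by
    refine Finset.measurable_sum _ fun i hi => (hNm n i).mul ?_
    exact (hXm _ ((hgrid n i (Finset.mem_range.1 hi)).trans ht)).mono (ℱ.le _) le_rfl
  refine ⟨fun ω => liminf (fun n => Y n ω) atTop, Measurable.liminf hYm, ?_, ?_⟩
  · filter_upwards [hc] with ω hω
    have hn := hN.isCountingPath ω
    refine (Tendsto.liminf_eq ?_).symm
    have : Tendsto (fun n => ∑ j ∈ Finset.range (N t ω),
        ‖X (gridLeft (δ n) (jumpTime (N · ω) j)) ω‖ₑ) atTop (𝓝 (∑ j ∈ Finset.range (N t ω),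
        ‖Function.leftLim (fun r => X r ω) (jumpTime (N · ω) j)‖ₑ)) := by
      refine tendsto_finsetSum _ fun j hj => Tendsto.enorm ?_
      have hj := Finset.mem_range.1 hj
      exact hω.tendsto_gridLeft hδ0 hδl (hn.jumpTime_pos hj)
        (((hn.lt_iff_jumpTime_le hj t).1 hj).trans ht)
    refine this.congr fun n => ?_
    have := hn.sum_gridLeft (δ n) (fun s => ‖X s ω‖ₑ) (n + 1)
    rw [hδt n] at this
    rw [this]
    simp [hY]
  · refine (lintegral_liminf_le hYm).trans ?_
    refine liminf_le_of_le (h := fun a ha => ?_)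
    obtain ⟨n, hn⟩ := ha.exists
    refine hn.trans ?_
    have h1 : ∫⁻ ω, Y n ω ∂P ≤ ∑ i ∈ Finset.range (n + 1), δ n * ψ (i * δ n) := by
      rw [lintegral_finsetSum _ fun i hi => ?_]
      · refine Finset.sum_le_sum fun i hi => ?_
        have hi := Finset.mem_range.1 hi
        have hle : (i : ℝ≥0) * δ n ≤ (i + 1 : ℕ) * δ n := by gcongr; simp
        -- The integrand at the left end of a cell is known before the increment, so the mean
        -- factors and the increment contributes the mesh.
        rw [lintegral_mul_eq_lintegral_mul_lintegral_of_independent_measurableSpace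
          (Measurable.comap_le ((hN.measurable _).sub (hN.measurable _))) (ℱ.le _)
          (hN.indep _ _ hle) ?_ (hXm _ ((hgrid n i hi).trans ht)), hN.lintegral_increment hle]
        · refine mul_le_mul' (le_of_eq ?_) (hb _ ((hgrid n i hi).trans ht))
          congr 1
          push_cast
          rw [add_mul, one_mul, add_tsub_cancel_left]
        · exact (measurable_of_countable fun k : ℕ => (k : ℝ≥0∞)).comp
            (comap_measurable _)
      · exact (hNm n i).mul ((hXm _ ((hgrid n i (Finset.mem_range.1 hi)).trans ht)).mono
          (ℱ.le _) le_rfl)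
    refine h1.trans ((sum_mul_mesh_le_lintegral hψ (δ n) (n + 1)).trans (le_of_eq ?_))
    rw [hδt n]

end LeftLimitMoments

/-! ### Bounds for the mean field interaction. -/

/-- `ρ ↦ A^ρ` as a continuous real-linear map. -/
noncomputable def meanFieldCLM {d : ℕ} (a : Matrix (Fin d × Fin d) (Fin d × Fin d) ℂ) :
    Matrix (Fin d) (Fin d) ℂ →L[ℝ] Matrix (Fin d) (Fin d) ℂ :=
  LinearMap.toContinuousLinearMap
    { toFun := meanFieldOp a
      map_add' := fun ρ σ => by
        ext x x'
        simp [meanFieldOp, mul_add, Finset.sum_add_distrib]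
      map_smul' := fun c ρ => by
        ext x x'
        simp [meanFieldOp, Finset.mul_sum, mul_left_comm] }

lemma meanFieldCLM_apply {d : ℕ} (a : Matrix (Fin d × Fin d) (Fin d × Fin d) ℂ)
    (ρ : Matrix (Fin d) (Fin d) ℂ) : meanFieldCLM a ρ = meanFieldOp a ρ := rfl

lemma enorm_meanFieldOp_le {d : ℕ} (a : Matrix (Fin d × Fin d) (Fin d × Fin d) ℂ)
    (ρ : Matrix (Fin d) (Fin d) ℂ) : ‖meanFieldOp a ρ‖ₑ ≤ ‖meanFieldCLM a‖ₑ * ‖ρ‖ₑ :=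
  (meanFieldCLM a).le_opENorm ρ

lemma IsGraphon.enorm_le {W : unitInterval → unitInterval → ℝ} (hW : IsGraphon W)
    (u v : unitInterval) : ‖W u v‖ₑ ≤ 1 := by
  rw [Real.enorm_eq_ofReal (hW.mem_Icc u v).1]
  exact ENNReal.ofReal_le_one.2 (hW.mem_Icc u v).2

lemma IsGraphon.integrable_smul {d : ℕ} {W : unitInterval → unitInterval → ℝ} (hW : IsGraphon W)
    (a : Matrix (Fin d × Fin d) (Fin d × Fin d) ℂ) {m : unitInterval → Matrix (Fin d) (Fin d) ℂ}
    (hm : Integrable m) (u : unitInterval) : Integrable fun v => W u v • meanFieldOp a (m v) := by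
  refine ((meanFieldCLM a).integrable_comp hm).bdd_smul 1
    (hW.measurable.of_uncurry_left (x := u)).aestronglyMeasurable
    (Eventually.of_forall fun v => ?_)
  rw [Real.norm_of_nonneg (hW.mem_Icc u v).1]
  exact (hW.mem_Icc u v).2

lemma IsGraphon.enorm_integral_le {d : ℕ} {W : unitInterval → unitInterval → ℝ}
    (hW : IsGraphon W) (a : Matrix (Fin d × Fin d) (Fin d × Fin d) ℂ)
    {m : unitInterval → Matrix (Fin d) (Fin d) ℂ} {b : ℝ≥0∞} (hm : ∀ v, ‖m v‖ₑ ≤ b)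
    (u : unitInterval) : ‖∫ v, W u v • meanFieldOp a (m v)‖ₑ ≤ ‖meanFieldCLM a‖ₑ * b := by
  refine (enorm_integral_le_lintegral_enorm _).trans ?_
  have h : ∀ v, ‖W u v • meanFieldOp a (m v)‖ₑ ≤ ‖meanFieldCLM a‖ₑ * b := fun v => by
    rw [enorm_smul]
    calc ‖W u v‖ₑ * ‖meanFieldOp a (m v)‖ₑ ≤ 1 * (‖meanFieldCLM a‖ₑ * b) :=
          mul_le_mul' (hW.enorm_le u v) ((enorm_meanFieldOp_le a _).trans
            (mul_le_mul_right (hm v) _))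
      _ = _ := one_mul _
  refine (lintegral_mono h).trans ?_
  simp

lemma enorm_mul_le_mul {A : Type*} [NormedRing A] (x y : A) : ‖x * y‖ₑ ≤ ‖x‖ₑ * ‖y‖ₑ := by
  rw [← ofReal_norm, ← ofReal_norm, ← ofReal_norm, ← ENNReal.ofReal_mul (norm_nonneg _)]
  exact ENNReal.ofReal_le_ofReal (norm_mul_le _ _)

/-- The splitting pairs `h` with the difference of states and `x'` with the difference of
Hamiltonians. For two solutions the Hamiltonians are deterministic, so taking means requires only
first moments of the states. -/
lemma enorm_commutator_sub_le {A : Type*} [NormedRing A] (h h' x x' : A) :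
    ‖(h * x - x * h) - (h' * x' - x' * h')‖ₑ
      ≤ 2 * ‖h‖ₑ * ‖x - x'‖ₑ + 2 * ‖h - h'‖ₑ * ‖x'‖ₑ := by
  have : (h * x - x * h) - (h' * x' - x' * h')
      = (h * (x - x') - (x - x') * h) + ((h - h') * x' - x' * (h - h')) := by noncomm_ring
  rw [this]
  refine (enorm_add_le _ _).trans (add_le_add ?_ ?_)
  · refine enorm_sub_le.trans ?_
    refine (add_le_add (enorm_mul_le_mul _ _) (enorm_mul_le_mul _ _)).trans (le_of_eq ?_)
    ring
  · refine enorm_sub_le.trans ?_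
    refine (add_le_add (enorm_mul_le_mul _ _) (enorm_mul_le_mul _ _)).trans (le_of_eq ?_)
    ring

/-! ### Gronwall estimate and pathwise uniqueness. -/

section Uniqueness

variable {d : ℕ} {Ω : Type*} {mΩ : MeasurableSpace Ω} {P : Measure Ω}
  {ℱ : Filtration ℝ≥0 mΩ} {N : unitInterval → ℝ≥0 → Ω → ℕ}
  {H L : Matrix (Fin d) (Fin d) ℂ} {a : Matrix (Fin d × Fin d) (Fin d × Fin d) ℂ}
  {W : unitInterval → unitInterval → ℝ} {ρ₀ : Matrix (Fin d) (Fin d) ℂ} {T : ℝ≥0}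
  {γ γ' : unitInterval → ℝ≥0 → Ω → Matrix (Fin d) (Fin d) ℂ}

namespace IsJumpGraphonSolution

lemma integrable_leftProcess (hγ : IsJumpGraphonSolution P ℱ N H L a W ρ₀ T γ)
    (v : unitInterval) {t : ℝ≥0} (ht : t ≤ T) : Integrable (leftProcess (γ v) t) P := by
  obtain ⟨C, hC⟩ := hγ.moment
  refine ⟨aestronglyMeasurable_leftLim (hγ.adapted v) (hγ.cadlag v) ht, ?_⟩
  exact (lintegral_enorm_leftLim_le (hγ.adapted v) (hγ.cadlag v) ht
    fun r hr => hC v r (hr.trans ht)).trans_lt ENNReal.coe_lt_top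

lemma enorm_mean_le (hγ : IsJumpGraphonSolution P ℱ N H L a W ρ₀ T γ) {C : ℝ≥0}
    (hC : ∀ u, ∀ t ≤ T, ∫⁻ ω, ‖γ u t ω‖ₑ ∂P ≤ C) (v : unitInterval) {t : ℝ≥0} (ht : t ≤ T) :
    ‖∫ ω, leftProcess (γ v) t ω ∂P‖ₑ ≤ C :=
  (enorm_integral_le_lintegral_enorm _).trans
    (lintegral_enorm_leftLim_le (hγ.adapted v) (hγ.cadlag v) ht
      fun r hr => hC v r (hr.trans ht))

lemma enorm_effectiveHamiltonian_le (hγ : IsJumpGraphonSolution P ℱ N H L a W ρ₀ T γ)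
    (hW : IsGraphon W) {C : ℝ≥0} (hC : ∀ u, ∀ t ≤ T, ∫⁻ ω, ‖γ u t ω‖ₑ ∂P ≤ C)
    (u : unitInterval) {t : ℝ≥0} (ht : t ≤ T) :
    ‖effectiveHamiltonian P H a W γ u t‖ₑ ≤ ‖H‖ₑ + ‖meanFieldCLM a‖ₑ * C :=
  (enorm_add_le _ _).trans (add_le_add le_rfl
    (hW.enorm_integral_le a (fun v => hγ.enorm_mean_le hC v ht) u))

lemma ae_leftLim_sub (hγ : IsJumpGraphonSolution P ℱ N H L a W ρ₀ T γ)
    (hγ' : IsJumpGraphonSolution P ℱ N H L a W ρ₀ T γ') (v : unitInterval) :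
    ∀ᵐ ω ∂P, ∀ t ≤ T, Function.leftLim (fun r => γ v r ω - γ' v r ω) t
      = leftProcess (γ v) t ω - leftProcess (γ' v) t ω := by
  filter_upwards [hγ.cadlag v, hγ'.cadlag v] with ω h1 h2 t ht
  exact h1.leftLim_sub h2 ht

lemma adapted_sub (hγ : IsJumpGraphonSolution P ℱ N H L a W ρ₀ T γ)
    (hγ' : IsJumpGraphonSolution P ℱ N H L a W ρ₀ T γ') (v : unitInterval) :
    ∀ t ≤ T, StronglyMeasurable[ℱ t] fun ω => γ v t ω - γ' v t ω := fun t ht =>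
  (hγ.adapted v t ht).sub (hγ'.adapted v t ht)

lemma cadlag_sub (hγ : IsJumpGraphonSolution P ℱ N H L a W ρ₀ T γ)
    (hγ' : IsJumpGraphonSolution P ℱ N H L a W ρ₀ T γ') (v : unitInterval) :
    ∀ᵐ ω ∂P, IsCadlagOn T fun t => γ v t ω - γ' v t ω := by
  filter_upwards [hγ.cadlag v, hγ'.cadlag v] with ω h1 h2
  exact h1.sub h2

/-- Since `ρ ↦ A^ρ` is additive and `0 ≤ W ≤ 1`, a bound on the mean distance uniform in `v`
suffices; no measurability in `v` of the distance itself is needed. -/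
lemma enorm_effectiveHamiltonian_sub_le (hγ : IsJumpGraphonSolution P ℱ N H L a W ρ₀ T γ)
    (hγ' : IsJumpGraphonSolution P ℱ N H L a W ρ₀ T γ') (hW : IsGraphon W) {b : ℝ≥0∞}
    {t : ℝ≥0} (ht : t ≤ T) (hb : ∀ v, ∀ s ≤ t, ∫⁻ ω, ‖γ v s ω - γ' v s ω‖ₑ ∂P ≤ b)
    (u : unitInterval) :
    ‖effectiveHamiltonian P H a W γ u t - effectiveHamiltonian P H a W γ' u t‖ₑ
      ≤ ‖meanFieldCLM a‖ₑ * b := by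
  unfold effectiveHamiltonian
  rw [add_sub_add_left_eq_sub, ← integral_sub (hW.integrable_smul a (hγ.mean_integrable t ht) u)
    (hW.integrable_smul a (hγ'.mean_integrable t ht) u)]
  have : ∀ v, W u v • meanFieldOp a (∫ ω, leftProcess (γ v) t ω ∂P)
      - W u v • meanFieldOp a (∫ ω, leftProcess (γ' v) t ω ∂P)
      = W u v • meanFieldOp a (∫ ω, (leftProcess (γ v) t ω - leftProcess (γ' v) t ω) ∂P) := by
    intro v
    rw [integral_sub (hγ.integrable_leftProcess v ht) (hγ'.integrable_leftProcess v ht),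
      ← smul_sub, ← meanFieldCLM_apply, ← meanFieldCLM_apply, ← meanFieldCLM_apply, map_sub]
  simp_rw [this]
  refine hW.enorm_integral_le a (fun v => (enorm_integral_le_lintegral_enorm _).trans ?_) u
  have h1 := lintegral_enorm_leftLim_le (adapted_sub hγ hγ' v) (cadlag_sub hγ hγ' v) ht
    fun r hr => hb v r hr
  refine le_trans (lintegral_mono_ae ?_) h1
  filter_upwards [ae_leftLim_sub hγ hγ' v] with ω hω
  rw [hω t ht]

/-- The Gronwall-type estimate for the difference of two solutions. -/
lemma lintegral_enorm_sub_le (hγ : IsJumpGraphonSolution P ℱ N H L a W ρ₀ T γ)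
    (hγ' : IsJumpGraphonSolution P ℱ N H L a W ρ₀ T γ')
    (hN : ∀ u, IsUnitPoissonProcess P ℱ (N u)) [SFinite P] (hW : IsGraphon W) {C : ℝ≥0}
    (hC : ∀ u, ∀ t ≤ T, ∫⁻ ω, ‖γ u t ω‖ₑ ∂P ≤ C)
    (hC' : ∀ u, ∀ t ≤ T, ∫⁻ ω, ‖γ' u t ω‖ₑ ∂P ≤ C) {ψ : ℝ≥0 → ℝ≥0∞} (hψ : Monotone ψ)
    (hb : ∀ v, ∀ s ≤ T, ∫⁻ ω, ‖γ v s ω - γ' v s ω‖ₑ ∂P ≤ ψ s) (u : unitInterval) {t : ℝ≥0}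
    (ht : t ≤ T) :
    ∫⁻ ω, ‖γ u t ω - γ' u t ω‖ₑ ∂P ≤ (2 * (‖H‖ₑ + ‖meanFieldCLM a‖ₑ * C)
      + 2 * ‖meanFieldCLM a‖ₑ * C + (‖L‖ₑ * ‖L.conjTranspose‖ₑ + 1))
        * ∫⁻ s in Set.Ioc (0 : ℝ) t, ψ s.toNNReal := by
  obtain ⟨G, hGm, hG1, hG2⟩ := exists_measurable_enorm_leftLim (adapted_sub hγ hγ' u)
    (cadlag_sub hγ hγ' u)
  obtain ⟨G', hGm', hG1', hG2'⟩ := exists_measurable_enorm_leftLim (hγ'.adapted u)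
    (hγ'.cadlag u)
  obtain ⟨F, hFm, hF1, hF2⟩ := exists_measurable_sum_jumps (hN u) (adapted_sub hγ hγ' u)
    (cadlag_sub hγ hγ' u) hψ (hb u) ht
  set κ := ‖meanFieldCLM a‖ₑ with hκ
  set h := ‖H‖ₑ + κ * C with hh
  have hψm : Measurable fun s : ℝ => ψ s.toNNReal := hψ.measurable.comp measurable_real_toNNReal
  have hsub : ∀ s : ℝ, s ∈ Set.Ioc 0 (t : ℝ) → s ∈ Set.Ioc 0 (T : ℝ) := fun s hs =>
    ⟨hs.1, hs.2.trans (NNReal.coe_le_coe.2 ht)⟩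
  have hsT : ∀ s : ℝ, s ∈ Set.Ioc 0 (t : ℝ) → s.toNNReal ≤ T := fun s hs =>
    Real.toNNReal_le_iff_le_coe.2 (hsub s hs).2
  -- The left limits are replaced by the measurable versions `G`, `G'` and `F`, so that Tonelli's
  -- theorem applies below.
  have hpath : ∀ᵐ ω ∂P, ‖γ u t ω - γ' u t ω‖ₑ
      ≤ (∫⁻ s in Set.Ioc (0 : ℝ) t, (2 * h * G (ω, s) + 2 * (κ * ψ s.toNNReal) * G' (ω, s)))
        + (‖L‖ₑ * ‖L.conjTranspose‖ₑ + 1) * F ω := by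
    filter_upwards [hG1, hG1', hF1, hγ.equation u, hγ'.equation u, hγ.drift_integrable u,
      hγ'.drift_integrable u, ae_leftLim_sub hγ hγ' u] with ω e1 e2 e3 e4 e5 e6 e7 e8
    have hsubI : Set.uIcc (0 : ℝ) t ⊆ Set.uIcc (0 : ℝ) T := by
      rw [Set.uIcc_of_le t.coe_nonneg, Set.uIcc_of_le T.coe_nonneg]
      exact Set.Icc_subset_Icc le_rfl (NNReal.coe_le_coe.2 ht)
    rw [e4 t ht, e5 t ht, add_sub_add_comm, add_sub_add_left_eq_sub,
      ← intervalIntegral.integral_sub (e6.mono_set hsubI) (e7.mono_set hsubI)]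
    refine (enorm_add_le _ _).trans (add_le_add ?_ ?_)
    · rw [intervalIntegral.integral_of_le t.coe_nonneg]
      refine (enorm_integral_le_lintegral_enorm _).trans
        (setLIntegral_mono' measurableSet_Ioc fun s hs => ?_)
      unfold jumpDrift
      rw [← smul_sub, enorm_smul, enorm_neg, ← ofReal_norm Complex.I, Complex.norm_I,
        ENNReal.ofReal_one, one_mul]
      refine (enorm_commutator_sub_le _ _ _ _).trans ?_
      rw [← e1 s (hsub s hs), ← e2 s (hsub s hs), e8 _ (hsT s hs)]
      gcongr
      · exact hγ.enorm_effectiveHamiltonian_le hW hC u (hsT s hs)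
      · exact hγ.enorm_effectiveHamiltonian_sub_le hγ' hW (hsT s hs)
          (fun v r hr => (hb v r (hr.trans (hsT s hs))).trans (hψ hr)) u
      · exact le_rfl
    · have hn := (hN u).isCountingPath ω
      rw [hn.countingIntegral_eq_sum, hn.countingIntegral_eq_sum, ← Finset.sum_sub_distrib,
        ← e3, Finset.mul_sum]
      refine (enorm_sum_le _ _).trans (Finset.sum_le_sum fun j hj => ?_)
      have hjT := ((hn.lt_iff_jumpTime_le (Finset.mem_range.1 hj) t).1
        (Finset.mem_range.1 hj)).trans ht
      rw [e8 _ hjT]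
      set x := leftProcess (γ u) (jumpTime (fun s => N u s ω) j) ω
      set y := leftProcess (γ' u) (jumpTime (fun s => N u s ω) j) ω
      have : L * x * L.conjTranspose - x - (L * y * L.conjTranspose - y)
          = L * (x - y) * L.conjTranspose - (x - y) := by noncomm_ring
      rw [this]
      refine enorm_sub_le.trans ?_
      rw [add_mul, one_mul]
      refine add_le_add ?_ le_rfl
      refine (enorm_mul_le_mul _ _).trans ((mul_le_mul_left (enorm_mul_le_mul _ _) _).trans
        (le_of_eq ?_))
      ring
  have hm1 : Measurable fun q : Ω × ℝ => 2 * h * G q + 2 * (κ * ψ q.2.toNNReal) * G' q :=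
    (hGm.const_mul _).add ((((hψm.comp measurable_snd).const_mul _).const_mul _).mul hGm')
  refine (lintegral_mono_ae hpath).trans ?_
  rw [lintegral_add_right _ (hFm.const_mul _), lintegral_const_mul _ hFm,
    add_mul _ (‖L‖ₑ * ‖L.conjTranspose‖ₑ + 1)]
  refine add_le_add ?_ (mul_le_mul_right hF2 _)
  rw [lintegral_lintegral_swap hm1.aemeasurable, ← lintegral_const_mul _ hψm]
  refine setLIntegral_mono' measurableSet_Ioc fun s hs => ?_
  have hGs : Measurable fun ω => G (ω, s) := hGm.comp (measurable_id.prodMk measurable_const)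
  have hGs' : Measurable fun ω => G' (ω, s) := hGm'.comp (measurable_id.prodMk measurable_const)
  rw [lintegral_add_left (hGs.const_mul _), lintegral_const_mul _ hGs,
    lintegral_const_mul _ hGs']
  have b1 : ∫⁻ ω, G (ω, s) ∂P ≤ ψ s.toNNReal := hG2 s (hsub s hs) _ fun r hr =>
    (hb u r (hr.le.trans (hsT s hs))).trans (hψ hr.le)
  have b2 : ∫⁻ ω, G' (ω, s) ∂P ≤ C := hG2' s (hsub s hs) _ fun r hr =>
    hC' u r (hr.le.trans (hsT s hs))
  refine (add_le_add (mul_le_mul_right b1 _) (mul_le_mul_right b2 _)).trans (le_of_eq ?_)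
  ring

/-- The iterated estimate: the weighted distance of two solutions is halved at each step. -/
lemma lintegral_enorm_sub_le_exp (hγ : IsJumpGraphonSolution P ℱ N H L a W ρ₀ T γ)
    (hγ' : IsJumpGraphonSolution P ℱ N H L a W ρ₀ T γ')
    (hN : ∀ u, IsUnitPoissonProcess P ℱ (N u)) [SFinite P] (hW : IsGraphon W) :
    ∃ D l : ℝ, ∀ m : ℕ, ∀ u, ∀ t ≤ T, ∫⁻ ω, ‖γ u t ω - γ' u t ω‖ₑ ∂P
      ≤ ENNReal.ofReal (D * (1 / 2) ^ m * Real.exp (l * t)) := by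
  obtain ⟨C₁, hC₁⟩ := hγ.moment
  obtain ⟨C₂, hC₂⟩ := hγ'.moment
  set C := max C₁ C₂ with hCdef
  have hC : ∀ u, ∀ t ≤ T, ∫⁻ ω, ‖γ u t ω‖ₑ ∂P ≤ C := fun u t ht =>
    (hC₁ u t ht).trans (ENNReal.coe_le_coe.2 (le_max_left _ _))
  have hC' : ∀ u, ∀ t ≤ T, ∫⁻ ω, ‖γ' u t ω‖ₑ ∂P ≤ C := fun u t ht =>
    (hC₂ u t ht).trans (ENNReal.coe_le_coe.2 (le_max_right _ _))
  obtain ⟨κ, hκ⟩ : ∃ κ : ℝ≥0, (κ : ℝ≥0∞) = 2 * (‖H‖ₑ + ‖meanFieldCLM a‖ₑ * C)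
      + 2 * ‖meanFieldCLM a‖ₑ * C + (‖L‖ₑ * ‖L.conjTranspose‖ₑ + 1) :=
    ⟨_, ENNReal.coe_toNNReal (by finiteness)⟩
  -- With this rate, `κ ∫₀ᵗ exp (l s) ds ≤ exp (l t) / 2`. The initial constant `2 * C` below is the
  -- sum of the two moment bounds.
  set l : ℝ := 2 * κ + 1 with hl
  have hl0 : 0 < l := by positivity
  refine ⟨2 * C, l, fun m => ?_⟩
  induction m with
  | zero =>
    intro u t ht
    have hm : Measurable fun ω => ‖γ u t ω‖ₑ := ((hγ.adapted u t ht).mono (ℱ.le t)).enorm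
    calc ∫⁻ ω, ‖γ u t ω - γ' u t ω‖ₑ ∂P ≤ ∫⁻ ω, (‖γ u t ω‖ₑ + ‖γ' u t ω‖ₑ) ∂P :=
          lintegral_mono fun ω => enorm_sub_le
      _ ≤ C + C := by rw [lintegral_add_left hm]; exact add_le_add (hC u t ht) (hC' u t ht)
      _ = ENNReal.ofReal (2 * C) := by
          rw [two_mul, ENNReal.ofReal_add C.coe_nonneg C.coe_nonneg, ENNReal.ofReal_coe_nnreal]
      _ ≤ _ := by
          refine ENNReal.ofReal_le_ofReal ?_
          have : 1 ≤ Real.exp (l * t) := Real.one_le_exp (by positivity)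
          rw [pow_zero, mul_one]
          exact le_mul_of_one_le_right (by positivity) this
  | succ m ih =>
    intro u t ht
    set D' : ℝ := 2 * C * (1 / 2) ^ m with hD'
    have hD'0 : 0 ≤ D' := by positivity
    have hmono : Monotone fun s : ℝ≥0 => ENNReal.ofReal (D' * Real.exp (l * s)) := by
      intro r s hrs
      have : (r : ℝ) ≤ s := hrs
      dsimp only
      gcongr
    refine (hγ.lintegral_enorm_sub_le hγ' hN hW hC hC' hmono ih u ht).trans ?_
    rw [← hκ]
    have h1 : ∫⁻ s in Set.Ioc (0 : ℝ) t, ENNReal.ofReal (D' * Real.exp (l * s.toNNReal))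
        = ENNReal.ofReal (∫ s in (0 : ℝ)..t, D' * Real.exp (l * s)) := by
      rw [intervalIntegral.integral_of_le t.coe_nonneg, ofReal_integral_eq_lintegral_ofReal]
      · refine setLIntegral_congr_fun measurableSet_Ioc fun s hs => ?_
        rw [Real.coe_toNNReal s hs.1.le]
      · have : Continuous fun s : ℝ => D' * Real.exp (l * s) := by fun_prop
        exact this.integrableOn_Ioc
      · exact Eventually.of_forall fun s => by positivity
    rw [h1, ← ENNReal.ofReal_coe_nnreal, ← ENNReal.ofReal_mul κ.coe_nonneg]
    refine ENNReal.ofReal_le_ofReal ?_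
    rw [intervalIntegral.integral_const_mul]
    have h2 := integral_exp_mul_le hl0 t
    have h3 : (κ : ℝ) / l ≤ 1 / 2 := by rw [div_le_div_iff₀ hl0 two_pos]; linarith
    calc (κ : ℝ) * (D' * ∫ s in (0 : ℝ)..t, Real.exp (l * s))
        ≤ κ * (D' * (Real.exp (l * t) / l)) := by gcongr
      _ = κ / l * (D' * Real.exp (l * t)) := by ring
      _ ≤ 1 / 2 * (D' * Real.exp (l * t)) := by gcongr
      _ = _ := by rw [hD']; ring

/-- Pathwise uniqueness for the jump graphon system. -/
theorem ae_eq (hγ : IsJumpGraphonSolution P ℱ N H L a W ρ₀ T γ)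
    (hγ' : IsJumpGraphonSolution P ℱ N H L a W ρ₀ T γ')
    (hN : ∀ u, IsUnitPoissonProcess P ℱ (N u)) [SFinite P] (hW : IsGraphon W)
    (u : unitInterval) : ∀ᵐ ω ∂P, ∀ t ≤ T, γ u t ω = γ' u t ω := by
  obtain ⟨D, l, hD⟩ := hγ.lintegral_enorm_sub_le_exp hγ' hN hW
  have hfix : ∀ t ≤ T, ∀ᵐ ω ∂P, γ u t ω = γ' u t ω := by
    intro t ht
    have hlim : Tendsto (fun m : ℕ => ENNReal.ofReal (D * (1 / 2) ^ m * Real.exp (l * t))) atTop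
        (𝓝 0) := by
      rw [← ENNReal.ofReal_zero]
      refine ENNReal.tendsto_ofReal ?_
      have := ((tendsto_pow_atTop_nhds_zero_of_lt_one (r := (1 / 2 : ℝ)) (by norm_num)
        (by norm_num)).const_mul D).mul_const (Real.exp (l * t))
      simpa using this
    have h0 : ∫⁻ ω, ‖γ u t ω - γ' u t ω‖ₑ ∂P = 0 :=
      le_antisymm (ge_of_tendsto' hlim fun m => hD m u t ht) zero_le
    rw [lintegral_eq_zero_iff (((adapted_sub hγ hγ' u t ht).mono (ℱ.le t)).enorm)] at h0
    filter_upwards [h0] with ω hω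
    exact sub_eq_zero.1 (enorm_eq_zero.1 hω)
  obtain ⟨S, hSc, hSd⟩ := TopologicalSpace.exists_countable_dense ℝ≥0
  -- Right-continuity extends equality from `S` to times before `T`; the endpoint has no times to
  -- its right and is inserted separately.
  have hS : ∀ᵐ ω ∂P, ∀ t ∈ insert T S, t ≤ T → γ u t ω = γ' u t ω := by
    rw [ae_ball_iff (hSc.insert T)]
    intro t _
    by_cases ht : t ≤ T
    · filter_upwards [hfix t ht] with ω hω _ using hω
    · exact Eventually.of_forall fun ω h => absurd h ht
  filter_upwards [hS, hγ.cadlag u, hγ'.cadlag u] with ω h1 h2 h3 t ht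
  rcases eq_or_lt_of_le ht with rfl | hlt
  · exact h1 t (Set.mem_insert _ _) le_rfl
  · have hcl : t ∈ closure (Set.Ioo t T ∩ S) :=
      closure_minimal (hSd.open_subset_closure_inter isOpen_Ioo) isClosed_closure
        (by rw [closure_Ioo hlt.ne]; exact ⟨le_rfl, ht⟩)
    have hne : (𝓝[Set.Ioo t T ∩ S] t).NeBot := mem_closure_iff_nhdsWithin_neBot.1 hcl
    have hss : Set.Ioo t T ∩ S ⊆ Set.Icc t T := fun s hs => ⟨hs.1.1.le, hs.1.2.le⟩
    refine tendsto_nhds_unique ((h2 t ht).1.mono hss) (((h3 t ht).1.mono hss).congr' ?_)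
    filter_upwards [self_mem_nhdsWithin] with s hs
    exact (h1 s (Set.mem_insert_of_mem _ hs.2) hs.1.2.le).symm

end IsJumpGraphonSolution

end Uniqueness

/-! ### The explicit solution along a counting path. -/

section JumpPath

variable {A : Type*} [CStarAlgebra A]

/-- The jump operator in the interaction picture. -/
noncomputable def rotatedJump (U : ℝ → A) (L : A) (s : ℝ≥0) : A := star (U s) * L * U s

/-- The evolution operator which has performed the first `k` jumps of the counting path `n`. -/
noncomputable def jumpFlow (n : ℝ≥0 → ℕ) (U : ℝ → A) (L : A) (k : ℕ) (t : ℝ) : A :=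
  U t * orderedProd (fun j => rotatedJump U L (jumpTime n j)) k

/-- The conjugation of `ρ` by `jumpFlow`. -/
noncomputable def jumpState (n : ℝ≥0 → ℕ) (U : ℝ → A) (L ρ : A) (k : ℕ) (t : ℝ) : A :=
  jumpFlow n U L k t * ρ * star (jumpFlow n U L k t)

/-- The path driven by the counting path `n` with Hamiltonian propagator `U`. -/
noncomputable def jumpPath (n : ℝ≥0 → ℕ) (U : ℝ → A) (L ρ : A) (t : ℝ≥0) : A :=
  jumpState n U L ρ (n t) t

lemma norm_le_one_of_mem_unitary {U : A} (hU : U ∈ unitary A) : ‖U‖ ≤ 1 := by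
  have h : ‖U‖ * ‖U‖ = ‖(1 : A)‖ := by rw [← CStarRing.norm_star_mul_self, hU.1]
  -- The algebra may be trivial, with `‖1‖ = 0`, so only `‖1‖ ≤ 1` is derived.
  have h1 : ‖(1 : A)‖ * ‖(1 : A)‖ = ‖(1 : A)‖ := by
    rw [← CStarRing.norm_star_mul_self, star_one, one_mul]
  have h2 : ‖(1 : A)‖ ≤ 1 := by nlinarith [norm_nonneg (1 : A)]
  nlinarith [norm_nonneg U]

lemma norm_conj_le {U : A} (hU : U ∈ unitary A) (x : A) : ‖U * x * star U‖ ≤ ‖x‖ := by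
  have h1 := norm_le_one_of_mem_unitary hU
  calc ‖U * x * star U‖ ≤ ‖U‖ * ‖x‖ * ‖star U‖ :=
        (norm_mul_le _ _).trans (by gcongr; exact norm_mul_le _ _)
    _ ≤ 1 * ‖x‖ * 1 := by rw [norm_star]; gcongr
    _ = ‖x‖ := by ring

lemma norm_conj_sub_conj_le {U V : A} (hU : U ∈ unitary A) (hV : V ∈ unitary A) (x : A) :
    ‖U * x * star U - V * x * star V‖ ≤ 2 * ‖x‖ * ‖U - V‖ := by
  have h1 := norm_le_one_of_mem_unitary hU
  have h2 := norm_le_one_of_mem_unitary hV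
  have : U * x * star U - V * x * star V = (U - V) * x * star U + V * x * star (U - V) := by
    rw [star_sub]; noncomm_ring
  rw [this]
  calc ‖(U - V) * x * star U + V * x * star (U - V)‖
      ≤ ‖U - V‖ * ‖x‖ * ‖star U‖ + ‖V‖ * ‖x‖ * ‖star (U - V)‖ :=
        (norm_add_le _ _).trans (add_le_add
          ((norm_mul_le _ _).trans (by gcongr; exact norm_mul_le _ _))
          ((norm_mul_le _ _).trans (by gcongr; exact norm_mul_le _ _)))
    _ ≤ ‖U - V‖ * ‖x‖ * 1 + 1 * ‖x‖ * ‖U - V‖ := by rw [norm_star, norm_star]; gcongr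
    _ = _ := by ring

lemma rotatedJump_mem {U : ℝ → A} {L : A} (hU : ∀ t, U t ∈ unitary A) (hL : L ∈ unitary A)
    (s : ℝ≥0) : rotatedJump U L s ∈ unitary A :=
  mul_mem (mul_mem (Unitary.star_mem (hU s)) hL) (hU s)

lemma continuous_rotatedJump {U : ℝ → A} (hU : Continuous U) (L : A) :
    Continuous (rotatedJump U L) := by
  have : Continuous fun s : ℝ≥0 => U s := hU.comp NNReal.continuous_coe
  exact (this.star.mul continuous_const).mul this

lemma jumpFlow_mem {n : ℝ≥0 → ℕ} {U : ℝ → A} {L : A} (hU : ∀ t, U t ∈ unitary A)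
    (hL : L ∈ unitary A) (k : ℕ) (t : ℝ) : jumpFlow n U L k t ∈ unitary A :=
  mul_mem (hU t) (orderedProd_mem (fun _ => rotatedJump_mem hU hL _) k)

/-- At the jump time the outer `U` cancels the `star U` of the newest rotated factor, leaving the
bare `L` on the left. -/
lemma jumpFlow_succ {n : ℝ≥0 → ℕ} {U : ℝ → A} {L : A} (hU : ∀ t, U t ∈ unitary A) (k : ℕ) :
    jumpFlow n U L (k + 1) (jumpTime n k) = L * jumpFlow n U L k (jumpTime n k) := by
  have h := (hU (jumpTime n k)).2
  simp only [jumpFlow, orderedProd, rotatedJump, ← mul_assoc]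
  rw [h, one_mul]

lemma jumpState_succ {n : ℝ≥0 → ℕ} {U : ℝ → A} {L : A} (hU : ∀ t, U t ∈ unitary A) (ρ : A)
    (k : ℕ) : jumpState n U L ρ (k + 1) (jumpTime n k)
      = L * jumpState n U L ρ k (jumpTime n k) * star L := by
  simp only [jumpState, jumpFlow_succ hU, star_mul, mul_assoc]

lemma jumpState_zero {n : ℝ≥0 → ℕ} {U : ℝ → A} (L ρ : A) (h0 : U 0 = 1) :
    jumpState n U L ρ 0 0 = ρ := by
  simp [jumpState, jumpFlow, orderedProd, h0]

lemma norm_jumpPath_le {n : ℝ≥0 → ℕ} {U : ℝ → A} {L : A} (hU : ∀ t, U t ∈ unitary A)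
    (hL : L ∈ unitary A) (ρ : A) (t : ℝ≥0) : ‖jumpPath n U L ρ t‖ ≤ ‖ρ‖ :=
  norm_conj_le (jumpFlow_mem hU hL _ _) ρ

lemma star_jumpPath {n : ℝ≥0 → ℕ} {U : ℝ → A} {L ρ : A} (hρ : star ρ = ρ) (t : ℝ≥0) :
    star (jumpPath n U L ρ t) = jumpPath n U L ρ t := by
  simp only [jumpPath, jumpState, star_mul, star_star, hρ, mul_assoc]

/-- Without a jump only `U` changes; with at least one jump the trivial bound `2 ‖ρ‖` is absorbed by
the number of jumps. Averaged over a Poisson process, this gives continuity of the mean in time. -/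
lemma norm_jumpPath_sub_le {n : ℝ≥0 → ℕ} {U : ℝ → A} {L : A} (hU : ∀ t, U t ∈ unitary A)
    (hL : L ∈ unitary A) (ρ : A) (hn : IsCountingPath n) {s t : ℝ≥0} (hst : s ≤ t) :
    ‖jumpPath n U L ρ t - jumpPath n U L ρ s‖
      ≤ 2 * ‖ρ‖ * ‖U t - U s‖ + 2 * ‖ρ‖ * ((n t - n s : ℕ) : ℝ) := by
  rcases Nat.eq_zero_or_pos (n t - n s) with h | h
  · have hnt : n t = n s := le_antisymm (by omega) (hn.monotone hst)
    rw [h, Nat.cast_zero, mul_zero, add_zero]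
    unfold jumpPath jumpState
    rw [hnt]
    refine (norm_conj_sub_conj_le (jumpFlow_mem hU hL _ _) (jumpFlow_mem hU hL _ _) ρ).trans ?_
    gcongr
    unfold jumpFlow
    rw [← sub_mul]
    refine (norm_mul_le _ _).trans (mul_le_of_le_one_right (norm_nonneg _) ?_)
    exact norm_le_one_of_mem_unitary (orderedProd_mem (fun _ => rotatedJump_mem hU hL _) _)
  · have h1 : (1 : ℝ) ≤ ((n t - n s : ℕ) : ℝ) := by exact_mod_cast h
    have h2 := norm_sub_le (jumpPath n U L ρ t) (jumpPath n U L ρ s)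
    have h3 := norm_jumpPath_le (n := n) hU hL ρ t
    have h4 := norm_jumpPath_le (n := n) hU hL ρ s
    have h5 : 0 ≤ 2 * ‖ρ‖ * ‖U t - U s‖ := by positivity
    have h6 : 2 * ‖ρ‖ * 1 ≤ 2 * ‖ρ‖ * ((n t - n s : ℕ) : ℝ) := by gcongr
    linarith

section Derivative

variable {n : ℝ≥0 → ℕ} {U U' h h' : ℝ → A} {L : A}

lemma hasDerivAt_jumpFlow (hU : ∀ t, HasDerivAt U (-Complex.I • h t * U t) t) (L : A) (k : ℕ)
    (t : ℝ) : HasDerivAt (jumpFlow n U L k) (-Complex.I • h t * jumpFlow n U L k t) t := by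
  have := (hU t).mul_const (orderedProd (fun j => rotatedJump U L (jumpTime n j)) k)
  rw [mul_assoc] at this
  exact this

lemma hasDerivAt_jumpState (hU : ∀ t, HasDerivAt U (-Complex.I • h t * U t) t)
    (hh : ∀ t, star (h t) = h t) (L ρ : A) (k : ℕ) (t : ℝ) :
    HasDerivAt (jumpState n U L ρ k) (-Complex.I • (h t * jumpState n U L ρ k t
      - jumpState n U L ρ k t * h t)) t := by
  have h1 := hasDerivAt_jumpFlow (n := n) hU L k t
  have h2 := (h1.mul_const ρ).mul h1.star
  have h3 : -Complex.I • h t * jumpFlow n U L k t * ρ * star (jumpFlow n U L k t)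
      + jumpFlow n U L k t * ρ * star (-Complex.I • h t * jumpFlow n U L k t)
      = -Complex.I • (h t * jumpState n U L ρ k t - jumpState n U L ρ k t * h t) := by
    have : star Complex.I = -Complex.I := by simp
    simp only [jumpState, star_mul, star_smul, star_neg, hh, this, smul_mul_assoc, mul_smul_comm,
      smul_sub, neg_smul, neg_mul, neg_neg, mul_assoc]
    abel
  rw [h3] at h2
  exact h2

/-- In the product of one flow's adjoint with the other flow, only the difference of the
Hamiltonians survives differentiation. -/
lemma hasDerivAt_star_jumpFlow_mul (hU : ∀ t, HasDerivAt U (-Complex.I • h t * U t) t)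
    (hU' : ∀ t, HasDerivAt U' (-Complex.I • h' t * U' t) t) (hh : ∀ t, star (h t) = h t)
    (L : A) (k : ℕ) (t : ℝ) :
    HasDerivAt (fun t => star (jumpFlow n U L k t) * jumpFlow n U' L k t)
      (Complex.I • (star (jumpFlow n U L k t) * (h t - h' t) * jumpFlow n U' L k t)) t := by
  have h1 := hasDerivAt_jumpFlow (n := n) hU L k t
  have h2 := hasDerivAt_jumpFlow (n := n) hU' L k t
  have h3 := h1.star.mul h2
  have h4 : star (-Complex.I • h t * jumpFlow n U L k t) * jumpFlow n U' L k t
      + star (jumpFlow n U L k t) * (-Complex.I • h' t * jumpFlow n U' L k t)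
      = Complex.I • (star (jumpFlow n U L k t) * (h t - h' t) * jumpFlow n U' L k t) := by
    have : star Complex.I = -Complex.I := by simp
    simp only [star_mul, star_smul, star_neg, hh, this, smul_mul_assoc, mul_smul_comm, mul_sub,
      sub_mul, smul_sub, neg_smul, neg_mul, mul_neg, neg_neg, mul_assoc]
    abel
  rw [h4] at h3
  exact h3

/-- Two evolution operators along the same jumps differ at most by the time integral of the
distance of the Hamiltonians. -/
lemma norm_jumpFlow_sub_le (hn : IsCountingPath n)
    (hU : ∀ t, HasDerivAt U (-Complex.I • h t * U t) t)
    (hU' : ∀ t, HasDerivAt U' (-Complex.I • h' t * U' t) t) (hh : ∀ t, star (h t) = h t)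
    (hc : Continuous h) (hc' : Continuous h') (hUu : ∀ t, U t ∈ unitary A)
    (hUu' : ∀ t, U' t ∈ unitary A) (hL : L ∈ unitary A) (h0 : U 0 = 1) (h0' : U' 0 = 1)
    {φ : ℝ → ℝ} (hφ : Continuous φ) (hb : ∀ s, 0 ≤ s → ‖h s - h' s‖ ≤ φ s) (k : ℕ) (t : ℝ≥0)
    (hk : k ≤ n t) :
    ‖jumpFlow n U L k t - jumpFlow n U' L k t‖ ≤ ∫ s in (0 : ℝ)..t, φ s := by
  set D : ℕ → ℝ → A := fun k t => star (jumpFlow n U L k t) * jumpFlow n U' L k t with hD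
  have hflow : ∀ {V g : ℝ → A}, (∀ t, HasDerivAt V (-Complex.I • g t * V t) t) → ∀ k,
      Continuous (jumpFlow n V L k) := fun hV k =>
    continuous_iff_continuousAt.2 fun t => (hasDerivAt_jumpFlow hV L k t).continuousAt
  have hstep : ∀ k (s t : ℝ), 0 ≤ s → s ≤ t → ‖D k t - D k s‖ ≤ ∫ r in s..t, φ r := by
    intro k s t hs hst
    have hcont : Continuous fun t => Complex.I •
        (star (jumpFlow n U L k t) * (h t - h' t) * jumpFlow n U' L k t) :=
      (((hflow hU k).star.mul (hc.sub hc')).mul (hflow hU' k)).const_smul _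
    rw [← intervalIntegral.integral_eq_sub_of_hasDerivAt
      (fun r _ => hasDerivAt_star_jumpFlow_mul (n := n) hU hU' hh L k r)
      (hcont.intervalIntegrable s t)]
    refine intervalIntegral.norm_integral_le_of_norm_le hst
      (Eventually.of_forall fun r hr => ?_) (hφ.intervalIntegrable _ _)
    rw [norm_smul, Complex.norm_I, one_mul]
    have h1 := norm_le_one_of_mem_unitary (jumpFlow_mem (n := n) hUu hL k r)
    have h2 := norm_le_one_of_mem_unitary (jumpFlow_mem (n := n) hUu' hL k r)
    calc _ ≤ ‖star (jumpFlow n U L k r)‖ * ‖h r - h' r‖ * ‖jumpFlow n U' L k r‖ :=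
          (norm_mul_le _ _).trans (by gcongr; exact norm_mul_le _ _)
      _ ≤ 1 * ‖h r - h' r‖ * 1 := by rw [norm_star]; gcongr
      _ ≤ φ r := by rw [one_mul, mul_one]; exact hb r (hs.trans hr.1.le)
  have hmain : ∀ k (t : ℝ≥0), k ≤ n t → ‖D k t - 1‖ ≤ ∫ s in (0 : ℝ)..t, φ s := by
    intro k
    induction k with
    | zero =>
      intro t _
      have h1 : D 0 0 = 1 := by simp [hD, jumpFlow, orderedProd, h0, h0']
      rw [← h1]
      exact hstep 0 0 t le_rfl t.coe_nonneg
    | succ k ih =>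
      intro t hk
      have hτ : jumpTime n k ≤ t := (hn.lt_iff_jumpTime_le hk t).1 hk
      have h1 := ih (jumpTime n k) (Nat.le_of_lt ((hn.lt_iff_jumpTime_le hk _).2 le_rfl))
      have h2 := hstep (k + 1) (jumpTime n k) t (NNReal.coe_nonneg _) (NNReal.coe_le_coe.2 hτ)
      -- The simultaneous jump cancels through `star L * L = 1`, so the errors on the successive
      -- intervals simply add up.
      have h3 : D (k + 1) (jumpTime n k) = D k (jumpTime n k) := by
        simp only [hD, jumpFlow_succ hUu, jumpFlow_succ hUu', star_mul]
        rw [mul_assoc, ← mul_assoc (star L), hL.1, one_mul]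
      rw [h3] at h2
      have h4 : D (k + 1) t - 1 = (D (k + 1) t - D k (jumpTime n k))
          + (D k (jumpTime n k) - 1) := by abel
      rw [h4, ← intervalIntegral.integral_add_adjacent_intervals
        (hφ.intervalIntegrable 0 (jumpTime n k)) (hφ.intervalIntegrable _ _), add_comm]
      exact (norm_add_le _ _).trans (by linarith)
  have h1 : jumpFlow n U L k t - jumpFlow n U' L k t = -(jumpFlow n U L k t * (D k t - 1)) := by
    rw [mul_sub, hD, ← mul_assoc, (jumpFlow_mem (n := n) hUu hL k t).2]
    simp
  rw [h1, norm_neg]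
  refine (norm_mul_le _ _).trans ((mul_le_of_le_one_left (norm_nonneg _)
    (norm_le_one_of_mem_unitary (jumpFlow_mem hUu hL k t))).trans (hmain k t hk))

/-- The left limits of the path. -/
lemma tendsto_jumpPath_left (hn : IsCountingPath n) (hU : Continuous U) (L ρ : A) (t : ℝ≥0) :
    Tendsto (jumpPath n U L ρ) (𝓝[<] t) (𝓝 (jumpState n U L ρ (Function.leftLim n t) t)) := by
  have hc : Continuous fun r : ℝ≥0 => jumpState n U L ρ (Function.leftLim n t) r := by
    have : Continuous fun r : ℝ≥0 => U r := hU.comp NNReal.continuous_coe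
    unfold jumpState jumpFlow
    exact ((this.mul continuous_const).mul continuous_const).mul
      (this.mul continuous_const).star
  refine ((hc.tendsto t).mono_left nhdsWithin_le_nhds).congr' ?_
  filter_upwards [hn.eventually_eq_left t] with r hr
  rw [jumpPath, hr]

lemma continuousWithinAt_jumpPath (hn : IsCountingPath n) (hU : Continuous U) (L ρ : A)
    (t : ℝ≥0) : ContinuousWithinAt (jumpPath n U L ρ) (Set.Ici t) t := by
  have hc : Continuous fun r : ℝ≥0 => jumpState n U L ρ (n t) r := by
    have : Continuous fun r : ℝ≥0 => U r := hU.comp NNReal.continuous_coe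
    unfold jumpState jumpFlow
    exact ((this.mul continuous_const).mul continuous_const).mul
      (this.mul continuous_const).star
  refine (hc.continuousWithinAt).congr_of_eventuallyEq ?_ rfl
  filter_upwards [hn.eventually_eq_right t] with r hr
  rw [jumpPath, hr]

lemma isCadlagOn_jumpPath (hn : IsCountingPath n) (hU : Continuous U) (L ρ : A) (T : ℝ≥0) :
    IsCadlagOn T (jumpPath n U L ρ) := fun t _ =>
  ⟨(continuousWithinAt_jumpPath hn hU L ρ t).mono Set.Icc_subset_Ici_self, _,
    tendsto_jumpPath_left hn hU L ρ t⟩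

lemma leftLim_jumpPath (hn : IsCountingPath n) (hU : Continuous U) (L ρ : A) (t : ℝ≥0) :
    Function.leftLim (jumpPath n U L ρ) t = jumpState n U L ρ (Function.leftLim n t) t := by
  rcases eq_or_lt_of_le (zero_le (a := t)) with rfl | h0
  · rw [leftLim_eq_of_isBot (fun x => zero_le), hn.leftLim_zero, jumpPath, hn.zero]
  · have : (𝓝[<] t).NeBot := nhdsLT_neBot_of_exists_lt ⟨0, h0⟩
    exact leftLim_eq_of_tendsto (tendsto_jumpPath_left hn hU L ρ t)

/-- The integral equation between jumps, summed over the jumps. -/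
lemma jumpState_eq_integral_add_sum (hn : IsCountingPath n)
    (hU : ∀ t, HasDerivAt U (-Complex.I • h t * U t) t) (hh : ∀ t, star (h t) = h t)
    (hc : Continuous h) (hUu : ∀ t, U t ∈ unitary A) (h0 : U 0 = 1) (L ρ : A) {F : ℝ → A}
    (hF : ∀ s : ℝ≥0, F s = -Complex.I • (h s * jumpState n U L ρ (Function.leftLim n s) s
      - jumpState n U L ρ (Function.leftLim n s) s * h s)) (k : ℕ) (t : ℝ≥0) (hk : k ≤ n t)
    (hk' : Function.leftLim n t ≤ k) :
    IntervalIntegrable F volume 0 t ∧ jumpState n U L ρ k t = ρ + (∫ s in (0 : ℝ)..t, F s)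
      + ∑ j ∈ Finset.range k, (L * jumpState n U L ρ j (jumpTime n j) * star L
        - jumpState n U L ρ j (jumpTime n j)) := by
  have hcont : ∀ k, Continuous (jumpState n U L ρ k) := fun k =>
    continuous_iff_continuousAt.2 fun t => (hasDerivAt_jumpState hU hh L ρ k t).continuousAt
  have hpiece : ∀ k (s t : ℝ≥0), s ≤ t → (∀ r, s < r → r ≤ t → Function.leftLim n r = k) →
      IntervalIntegrable F volume s t ∧
        ∫ r in (s : ℝ)..t, F r = jumpState n U L ρ k t - jumpState n U L ρ k s := by
    intro k s t hst hleft
    have hst' : (s : ℝ) ≤ t := hst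
    set F' : ℝ → A := fun r => -Complex.I • (h r * jumpState n U L ρ k r
      - jumpState n U L ρ k r * h r) with hF'
    have hF'c : Continuous F' := ((hc.mul (hcont k)).sub ((hcont k).mul hc)).const_smul _
    -- Between jumps `F` agrees with a continuous function, including at the right endpoint, where
    -- the left limit has not yet seen a new jump.
    have heq : Set.EqOn F' F (Set.uIoc (s : ℝ) t) := by
      intro r hr
      rw [Set.uIoc_of_le hst'] at hr
      have hr0 : 0 ≤ r := s.coe_nonneg.trans hr.1.le
      lift r to ℝ≥0 using hr0
      rw [hF r, hleft r (NNReal.coe_lt_coe.1 hr.1) (NNReal.coe_le_coe.1 hr.2)]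
    refine ⟨(hF'c.intervalIntegrable _ _).congr heq, ?_⟩
    rw [← intervalIntegral.integral_congr_ae (f := F') (Eventually.of_forall fun r hr => heq hr)]
    exact intervalIntegral.integral_eq_sub_of_hasDerivAt
      (fun r _ => hasDerivAt_jumpState hU hh L ρ k r) (hF'c.intervalIntegrable _ _)
  induction k generalizing t with
  | zero =>
    obtain ⟨h1, h2⟩ := hpiece 0 0 t zero_le fun r _ hr =>
      Nat.le_zero.1 ((hn.monotone.leftLim hr).trans hk')
    rw [NNReal.coe_zero] at h1 h2
    refine ⟨h1, ?_⟩
    rw [h2, jumpState_zero L ρ h0]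
    simp
  | succ k ih =>
    have hτ : jumpTime n k ≤ t := (hn.lt_iff_jumpTime_le hk t).1 hk
    -- Several jumps may coincide, so at this time `k` need equal neither the left limit nor the
    -- value of `n`; the induction only requires it to lie between them.
    have hτ' := (hn.jumpTime_eq_iff hk (jumpTime n k)).1 rfl
    obtain ⟨i1, e1⟩ := ih (jumpTime n k) hτ'.2.le hτ'.1
    obtain ⟨i2, e2⟩ := hpiece (k + 1) (jumpTime n k) t hτ fun r h1 h2 =>
      le_antisymm ((hn.monotone.leftLim h2).trans hk')
        ((hn.lt_leftLim_iff_jumpTime_lt hk r).2 h1)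
    refine ⟨i1.trans i2, ?_⟩
    rw [← intervalIntegral.integral_add_adjacent_intervals i1 i2, e2, Finset.sum_range_succ,
      jumpState_succ hUu]
    have : ∀ a b c d e : A, d = a + b + c → e = a + (b + (e - L * d * star L))
        + (c + (L * d * star L - d)) := by
      intro a b c d e hd
      nth_rewrite 3 [hd]
      abel
    exact this _ _ _ _ _ e1

end Derivative

end JumpPath

/-! ### Means of the explicit path. -/

/-- The mean of a random element, acted upon by operators indexed by an independent natural
number. -/
lemma integral_apply_of_indep {Ω A : Type*} {m mΩ : MeasurableSpace Ω} {P : Measure Ω}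
    [IsProbabilityMeasure P] [NormedAddCommGroup A] [NormedSpace ℝ A] [CompleteSpace A]
    [SecondCountableTopology A] {μ : Measure ℕ} {K : Ω → ℕ} (hKm : Measurable K)
    (hK : HasLaw K μ P) (hm : m ≤ mΩ)
    (hi : Indep (MeasurableSpace.comap K inferInstance) m P) {Y : Ω → A}
    (hY : StronglyMeasurable[m] Y) {C : ℝ} (hYC : ∀ ω, ‖Y ω‖ ≤ C) {F : ℕ → A →L[ℝ] A}
    (hF : ∀ j, ‖F j‖ ≤ 1) :
    ∫ ω, F (K ω) (Y ω) ∂P = ∫ j, F j (∫ ω, Y ω ∂P) ∂μ := by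
  borelize A
  have hYm : Measurable Y := (hY.mono hm).measurable
  have hind : IndepFun K Y P := indep_of_indep_of_le_right hi hY.measurable.comap_le
  have hlaw := (indepFun_iff_map_prod_eq_prod_map_map hKm.aemeasurable hYm.aemeasurable).1 hind
  rw [hK.map_eq] at hlaw
  have : IsProbabilityMeasure μ := hK.map_eq ▸ Measure.isProbabilityMeasure_map hKm.aemeasurable
  have : IsProbabilityMeasure (P.map Y) := Measure.isProbabilityMeasure_map hYm.aemeasurable
  have hjoint : Measurable fun q : ℕ × A => F q.1 q.2 :=
    measurable_from_prod_countable_right fun j => (F j).continuous.measurable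
  have hFY : ∀ ω, ‖F (K ω) (Y ω)‖ ≤ C := fun ω =>
    ((F (K ω)).le_of_opNorm_le (hF _) _).trans (by rw [one_mul]; exact hYC ω)
  have hint : Integrable (fun q : ℕ × A => F q.1 q.2) (μ.prod (P.map Y)) := by
    rw [← hlaw, integrable_map_measure hjoint.aestronglyMeasurable
      (hKm.prodMk hYm).aemeasurable]
    exact Integrable.of_bound (hjoint.comp (hKm.prodMk hYm)).aestronglyMeasurable C
      (Eventually.of_forall hFY)
  have hYi : Integrable Y P := Integrable.of_bound hYm.aestronglyMeasurable C
    (Eventually.of_forall hYC)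
  calc ∫ ω, F (K ω) (Y ω) ∂P = ∫ q, F q.1 q.2 ∂(P.map fun ω => (K ω, Y ω)) :=
        (integral_map (hKm.prodMk hYm).aemeasurable hjoint.aestronglyMeasurable).symm
    _ = ∫ j, ∫ y, F j y ∂(P.map Y) ∂μ := by rw [hlaw, integral_prod _ hint]
    _ = ∫ j, F j (∫ ω, Y ω ∂P) ∂μ := by
        congr 1
        funext j
        rw [integral_map hYm.aemeasurable (F j).continuous.measurable.aestronglyMeasurable,
          (F j).integral_comp_comm hYi]

section JumpMean

variable {A : Type*} [CStarAlgebra A]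

/-- Conjugation as a continuous linear map. -/
noncomputable def conjCLM (b : A) : A →L[ℝ] A :=
  ((ContinuousLinearMap.mul ℝ A).flip (star b)).comp (ContinuousLinearMap.mul ℝ A b)

lemma conjCLM_apply (b x : A) : conjCLM b x = b * x * star b := rfl

lemma norm_conjCLM_le {b : A} (hb : b ∈ unitary A) : ‖conjCLM b‖ ≤ 1 :=
  ContinuousLinearMap.opNorm_le_bound _ zero_le_one fun x => by
    rw [one_mul, conjCLM_apply]; exact norm_conj_le hb x

/-- The mean after `k` steps of length `δ`, with a Poisson number of jumps in each step. -/
noncomputable def meanStep (b : ℕ → A) (δ : ℝ≥0) (ρ : A) : ℕ → A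
  | 0 => ρ
  | k + 1 => ∫ j, b k ^ j * meanStep b δ ρ k * star (b k ^ j) ∂(poissonMeasure δ)

lemma stronglyMeasurable_meanStep {Λ : Type*} [MeasurableSpace Λ] {b : Λ → ℕ → A}
    (hb : ∀ k, StronglyMeasurable fun u => b u k) (δ : ℝ≥0) (ρ : A) (k : ℕ) :
    StronglyMeasurable fun u => meanStep (b u) δ ρ k := by
  induction k with
  | zero => exact stronglyMeasurable_const
  | succ k ih =>
    have h1 : StronglyMeasurable (Function.uncurry fun (j : ℕ) (u : Λ) =>
        b u k ^ j * meanStep (b u) δ ρ k * star (b u k ^ j)) :=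
      stronglyMeasurable_uncurry_of_continuous_of_stronglyMeasurable
        (fun u => continuous_of_discreteTopology)
        (fun j => (((hb k).pow j).mul ih).mul ((hb k).pow j).star)
    exact (h1.comp_measurable measurable_swap).integral_prod_right'

variable {Ω : Type*} {mΩ : MeasurableSpace Ω} {P : Measure Ω} {ℱ : Filtration ℝ≥0 mΩ}
  {N : ℝ≥0 → Ω → ℕ} {U : ℝ → A} {L : A}

/-- The product over the jumps with the jump operators frozen on the grid of mesh `δ`. -/
noncomputable def gridProd (n : ℝ≥0 → ℕ) (U : ℝ → A) (L : A) (δ : ℝ≥0) (t : ℝ≥0) : A :=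
  orderedProd (fun j => rotatedJump U L (gridLeft δ (jumpTime n j))) (n t)

lemma gridProd_mem {n : ℝ≥0 → ℕ} (hU : ∀ t, U t ∈ unitary A) (hL : L ∈ unitary A)
    (δ t : ℝ≥0) : gridProd n U L δ t ∈ unitary A :=
  orderedProd_mem (fun _ => rotatedJump_mem hU hL _) _

/-- Passing one cell multiplies by a power of a fixed operator, whose exponent is the increment over
that cell. -/
lemma stronglyMeasurable_gridProd (hN : IsUnitPoissonProcess P ℱ N) (U : ℝ → A) (L : A)
    (δ : ℝ≥0) (k : ℕ) :
    StronglyMeasurable[ℱ (k * δ)] fun ω => gridProd (N · ω) U L δ (k * δ) := by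
  induction k with
  | zero =>
    have : (fun ω => gridProd (N · ω) U L δ ((0 : ℕ) * δ)) = fun _ => (1 : A) := by
      funext ω
      simp [gridProd, hN.zero ω, orderedProd]
    rw [this]
    exact stronglyMeasurable_const
  | succ k ih =>
    have hle : (k : ℝ≥0) * δ ≤ (k + 1 : ℕ) * δ := by gcongr; simp
    have h1 : (fun ω => gridProd (N · ω) U L δ ((k + 1 : ℕ) * δ)) = fun ω =>
        rotatedJump U L (k * δ) ^ (N ((k + 1 : ℕ) * δ) ω - N (k * δ) ω)
          * gridProd (N · ω) U L δ (k * δ) := by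
      funext ω
      exact (hN.isCountingPath ω).orderedProd_gridLeft δ (rotatedJump U L) k
    rw [h1]
    have h2 : Measurable[ℱ ((k + 1 : ℕ) * δ)] fun ω =>
        N ((k + 1 : ℕ) * δ) ω - N (k * δ) ω :=
      (hN.adapted _).sub ((hN.adapted _).mono (ℱ.mono hle) le_rfl)
    have h3 : StronglyMeasurable fun j : ℕ => rotatedJump U L (k * δ) ^ j :=
      StronglyMeasurable.of_discrete
    exact (h3.comp_measurable h2).mul (ih.mono (ℱ.mono hle))

/-- In each new cell the exponent is Poisson and independent of the product built so far. Averaging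
it out yields one step of the recursion, in which only the law of the process remains. -/
lemma integral_gridProd [IsProbabilityMeasure P] [SecondCountableTopology A]
    (hN : IsUnitPoissonProcess P ℱ N) (hU : ∀ t, U t ∈ unitary A) (hL : L ∈ unitary A) (ρ : A)
    (δ : ℝ≥0) (k : ℕ) :
    ∫ ω, gridProd (N · ω) U L δ (k * δ) * ρ * star (gridProd (N · ω) U L δ (k * δ)) ∂P
      = meanStep (fun i => rotatedJump U L (i * δ)) δ ρ k := by
  induction k with
  | zero => simp [gridProd, hN.zero, orderedProd, meanStep]
  | succ k ih =>
    have hle : (k : ℝ≥0) * δ ≤ (k + 1 : ℕ) * δ := by gcongr; simp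
    have hsub : ((k + 1 : ℕ) : ℝ≥0) * δ - k * δ = δ := by
      push_cast
      rw [add_mul, one_mul, add_tsub_cancel_left]
    have hlaw := hN.law _ _ hle
    rw [hsub] at hlaw
    have hm := stronglyMeasurable_gridProd hN U L δ k
    set Y : Ω → A := fun ω => gridProd (N · ω) U L δ (k * δ) * ρ
      * star (gridProd (N · ω) U L δ (k * δ)) with hY
    have hYm : StronglyMeasurable[ℱ (k * δ)] Y :=
      (hm.mul stronglyMeasurable_const).mul (continuous_star.comp_stronglyMeasurable hm)
    have h1 := integral_apply_of_indep ((hN.measurable _).sub (hN.measurable _)) hlaw (ℱ.le _)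
      (hN.indep _ _ hle) hYm (C := ‖ρ‖)
      (fun ω => norm_conj_le (gridProd_mem hU hL δ _) ρ)
      (F := fun j => conjCLM (rotatedJump U L (k * δ) ^ j))
      (fun j => norm_conjCLM_le (pow_mem (rotatedJump_mem hU hL _) j))
    rw [meanStep, ← ih]
    simp only [conjCLM_apply] at h1
    refine Eq.trans ?_ h1
    congr 1
    funext ω
    have := (hN.isCountingPath ω).orderedProd_gridLeft δ (rotatedJump U L) k
    simp only [hY]
    unfold gridProd
    rw [this]
    simp only [Pi.sub_apply, star_mul, mul_assoc]

lemma tendsto_gridProd {n : ℝ≥0 → ℕ} (hn : IsCountingPath n) (hU : Continuous U) (L : A)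
    {t : ℝ≥0} (ht : 0 < t) :
    Tendsto (fun m : ℕ => gridProd n U L (t / ((m : ℝ≥0) + 1)) t) atTop
      (𝓝 (orderedProd (fun j => rotatedJump U L (jumpTime n j)) (n t))) := by
  refine tendsto_orderedProd fun j hj => ?_
  have h1 := tendsto_gridLeft (fun m : ℕ => (by positivity : 0 < t / ((m : ℝ≥0) + 1)))
    (tendsto_meshSize t) (hn.jumpTime_pos hj)
  exact ((continuous_rotatedJump hU L).tendsto _).comp (h1.mono_right nhdsWithin_le_nhds)

/-- The mesh divides `t`, so every approximating grid ends exactly at `t` and uses no information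
beyond `ℱ t`. -/
lemma stronglyMeasurable_jumpPath (hN : IsUnitPoissonProcess P ℱ N) (hU : Continuous U)
    (L ρ : A) (t : ℝ≥0) : StronglyMeasurable[ℱ t] fun ω => jumpPath (N · ω) U L ρ t := by
  have h : StronglyMeasurable[ℱ t] fun ω =>
      orderedProd (fun j => rotatedJump U L (jumpTime (N · ω) j)) (N t ω) := by
    rcases eq_or_lt_of_le (zero_le (a := t)) with rfl | h0
    · simp only [hN.zero, orderedProd]
      exact stronglyMeasurable_const
    · refine stronglyMeasurable_of_tendsto atTop (fun m : ℕ => ?_)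
        (tendsto_pi_nhds.2 fun ω => tendsto_gridProd (hN.isCountingPath ω) hU L h0)
      have := stronglyMeasurable_gridProd hN U L (t / ((m : ℝ≥0) + 1)) (m + 1)
      rw [meshSize_mul] at this
      exact this
  exact ((h.const_mul _).mul stronglyMeasurable_const).mul (continuous_star.comp_stronglyMeasurable (h.const_mul _))

lemma integrable_jumpPath [IsFiniteMeasure P] (hN : IsUnitPoissonProcess P ℱ N)
    (hU : Continuous U) (hUu : ∀ t, U t ∈ unitary A) (hL : L ∈ unitary A) (ρ : A) (t : ℝ≥0) :
    Integrable (fun ω => jumpPath (N · ω) U L ρ t) P :=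
  Integrable.of_bound ((stronglyMeasurable_jumpPath hN hU L ρ t).mono
    (ℱ.le t)).aestronglyMeasurable ‖ρ‖ (Eventually.of_forall fun _ => norm_jumpPath_le hUu hL ρ t)

/-- The mean of the path as a limit of explicit expressions. -/
lemma tendsto_meanStep [IsProbabilityMeasure P] [SecondCountableTopology A]
    (hN : IsUnitPoissonProcess P ℱ N) (hU : Continuous U) (hUu : ∀ t, U t ∈ unitary A)
    (hL : L ∈ unitary A) (ρ : A) {t : ℝ≥0} (ht : 0 < t) :
    Tendsto (fun m : ℕ => U t * meanStep (fun i => rotatedJump U L (i * (t / ((m : ℝ≥0) + 1))))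
        (t / ((m : ℝ≥0) + 1)) ρ (m + 1) * star (U t)) atTop
      (𝓝 (∫ ω, jumpPath (N · ω) U L ρ t ∂P)) := by
  have h1 : ∀ m : ℕ, U t * meanStep (fun i => rotatedJump U L (i * (t / ((m : ℝ≥0) + 1))))
        (t / ((m : ℝ≥0) + 1)) ρ (m + 1) * star (U t)
      = ∫ ω, (U t * gridProd (N · ω) U L (t / ((m : ℝ≥0) + 1)) t) * ρ
        * star (U t * gridProd (N · ω) U L (t / ((m : ℝ≥0) + 1)) t) ∂P := by
    intro m
    have hg := integral_gridProd hN hUu hL ρ (t / ((m : ℝ≥0) + 1)) (m + 1)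
    have hm := stronglyMeasurable_gridProd hN U L (t / ((m : ℝ≥0) + 1)) (m + 1)
    rw [meshSize_mul] at hg hm
    have hi : Integrable (fun ω => gridProd (N · ω) U L (t / ((m : ℝ≥0) + 1)) t * ρ
        * star (gridProd (N · ω) U L (t / ((m : ℝ≥0) + 1)) t)) P :=
      Integrable.of_bound (((hm.mul stronglyMeasurable_const).mul
        (continuous_star.comp_stronglyMeasurable hm)).mono
        (ℱ.le t)).aestronglyMeasurable ‖ρ‖
        (Eventually.of_forall fun _ => norm_conj_le (gridProd_mem hUu hL _ _) ρ)
    rw [← hg, ← conjCLM_apply, ← (conjCLM (U t)).integral_comp_comm hi]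
    simp only [conjCLM_apply, star_mul, mul_assoc]
  simp_rw [h1]
  refine tendsto_integral_of_dominated_convergence (fun _ => ‖ρ‖) (fun m => ?_)
    (integrable_const _) (fun m => Eventually.of_forall fun ω =>
      norm_conj_le (mul_mem (hUu t) (gridProd_mem hUu hL _ _)) ρ)
    (Eventually.of_forall fun ω => ?_)
  · have hm := stronglyMeasurable_gridProd hN U L (t / ((m : ℝ≥0) + 1)) (m + 1)
    rw [meshSize_mul] at hm
    exact ((((hm.const_mul _).mul stronglyMeasurable_const).mul (continuous_star.comp_stronglyMeasurable (hm.const_mul _))).mono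
      (ℱ.le t)).aestronglyMeasurable
  · have := (tendsto_gridProd (hN.isCountingPath ω) hU L ht).const_mul (U t)
    exact (this.mul tendsto_const_nhds).mul this.star

/-- The mean of the path depends measurably on a parameter of the Hamiltonian, even though the
driving processes may depend on it in an arbitrary way. -/
lemma stronglyMeasurable_integral_jumpPath {Λ : Type*} [MeasurableSpace Λ]
    [IsProbabilityMeasure P] [SecondCountableTopology A] {N : Λ → ℝ≥0 → Ω → ℕ}
    (hN : ∀ u, IsUnitPoissonProcess P ℱ (N u)) {U : Λ → ℝ → A} (hU : ∀ u, Continuous (U u))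
    (hUu : ∀ u t, U u t ∈ unitary A) (h0 : ∀ u, U u 0 = 1)
    (hUm : ∀ t, StronglyMeasurable fun u => U u t) (hL : L ∈ unitary A) (ρ : A) (t : ℝ≥0) :
    StronglyMeasurable fun u => ∫ ω, jumpPath (N u · ω) (U u) L ρ t ∂P := by
  rcases eq_or_lt_of_le (zero_le (a := t)) with rfl | ht
  · have : ∀ u ω, jumpPath (N u · ω) (U u) L ρ 0 = ρ := fun u ω => by
      rw [jumpPath, (hN u).zero ω, NNReal.coe_zero, jumpState_zero L ρ (h0 u)]
    simp_rw [this]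
    exact stronglyMeasurable_const
  -- The approximating expressions contain `u` only through `U u`; the process `N u` has been
  -- averaged out.
  · refine stronglyMeasurable_of_tendsto atTop (fun m : ℕ => ?_)
      (tendsto_pi_nhds.2 fun u => tendsto_meanStep (hN u) (hU u) (hUu u) hL ρ ht)
    have h1 : ∀ s : ℝ≥0, StronglyMeasurable fun u => rotatedJump (U u) L s := fun s =>
      ((hUm s).star.mul stronglyMeasurable_const).mul (hUm s)
    exact ((hUm t).mul (stronglyMeasurable_meanStep (fun i => h1 _) _ ρ _)).mul (hUm t).star

/-- The mean of the path is continuous in time. -/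
lemma continuous_integral_jumpPath [IsProbabilityMeasure P]
    (hN : IsUnitPoissonProcess P ℱ N) (hU : Continuous U) (hUu : ∀ t, U t ∈ unitary A)
    (hL : L ∈ unitary A) (ρ : A) : Continuous fun t => ∫ ω, jumpPath (N · ω) U L ρ t ∂P := by
  have key : ∀ s t : ℝ≥0, s ≤ t → ‖(∫ ω, jumpPath (N · ω) U L ρ t ∂P)
      - ∫ ω, jumpPath (N · ω) U L ρ s ∂P‖ ≤ 2 * ‖ρ‖ * ‖U t - U s‖ + 2 * ‖ρ‖ * (t - s : ℝ≥0) := by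
    intro s t hst
    rw [← integral_sub (integrable_jumpPath hN hU hUu hL ρ t)
      (integrable_jumpPath hN hU hUu hL ρ s)]
    have hm : Measurable fun ω => ((N t ω - N s ω : ℕ) : ℝ) :=
      (measurable_of_countable fun k : ℕ => (k : ℝ)).comp
        ((hN.measurable _).sub (hN.measurable _))
    have hl : ∫⁻ ω, ENNReal.ofReal ((N t ω - N s ω : ℕ) : ℝ) ∂P = ((t - s : ℝ≥0) : ℝ≥0∞) := by
      simp_rw [ENNReal.ofReal_natCast]
      exact hN.lintegral_increment hst
    have hi : Integrable (fun ω => ((N t ω - N s ω : ℕ) : ℝ)) P := by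
      refine ⟨hm.aestronglyMeasurable, ?_⟩
      rw [hasFiniteIntegral_iff_ofReal (Eventually.of_forall fun ω => Nat.cast_nonneg _), hl]
      exact ENNReal.coe_lt_top
    have he : ∫ ω, ((N t ω - N s ω : ℕ) : ℝ) ∂P = (t - s : ℝ≥0) := by
      rw [integral_eq_lintegral_of_nonneg_ae (Eventually.of_forall fun ω => Nat.cast_nonneg _)
        hm.aestronglyMeasurable, hl, ENNReal.coe_toReal]
    refine (norm_integral_le_of_norm_le ((integrable_const _).add (hi.const_mul _))
      (Eventually.of_forall fun ω => norm_jumpPath_sub_le hUu hL ρ (hN.isCountingPath ω) hst)).trans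
      (le_of_eq ?_)
    simp only [Pi.add_apply]
    rw [integral_add (integrable_const _) (hi.const_mul _), integral_const, integral_const_mul, he]
    simp
  have key' : ∀ s t : ℝ≥0, ‖(∫ ω, jumpPath (N · ω) U L ρ t ∂P)
      - ∫ ω, jumpPath (N · ω) U L ρ s ∂P‖
      ≤ 2 * ‖ρ‖ * ‖U t - U s‖ + 2 * ‖ρ‖ * |(t : ℝ) - s| := by
    intro s t
    rcases le_total s t with h | h
    · have := key s t h
      rwa [NNReal.coe_sub h, ← abs_of_nonneg (sub_nonneg.2 (NNReal.coe_le_coe.2 h))] at this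
    · have := key t s h
      rwa [NNReal.coe_sub h, ← abs_of_nonneg (sub_nonneg.2 (NNReal.coe_le_coe.2 h)),
        norm_sub_rev, norm_sub_rev (U s), abs_sub_comm] at this
  refine continuous_iff_continuousAt.2 fun s => ?_
  rw [ContinuousAt, tendsto_iff_norm_sub_tendsto_zero]
  refine squeeze_zero (fun _ => norm_nonneg _) (fun t => key' s t) ?_
  have hc : Continuous fun t : ℝ≥0 => 2 * ‖ρ‖ * ‖U t - U s‖ + 2 * ‖ρ‖ * |(t : ℝ) - s| := by
    have : Continuous fun t : ℝ≥0 => U t := hU.comp NNReal.continuous_coe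
    fun_prop
  have := hc.tendsto s
  simpa using this

/-- The mean of the left limits of the path is the mean of the path. -/
lemma integral_leftLim_jumpPath [IsProbabilityMeasure P] (hN : IsUnitPoissonProcess P ℱ N)
    (hU : Continuous U) (hUu : ∀ t, U t ∈ unitary A) (hL : L ∈ unitary A) (ρ : A) (t : ℝ≥0) :
    ∫ ω, Function.leftLim (jumpPath (N · ω) U L ρ) t ∂P = ∫ ω, jumpPath (N · ω) U L ρ t ∂P := by
  rcases eq_or_lt_of_le (zero_le (a := t)) with rfl | ht
  · simp_rw [fun ω => leftLim_eq_of_isBot (f := jumpPath (N · ω) U L ρ)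
      (a := (0 : ℝ≥0)) (fun x => zero_le)]
  -- Along grid times increasing to `t` the means converge both to the mean of the left limits, by
  -- domination, and to the mean at `t`, by continuity.
  · have hs := tendsto_gridLeft (fun m : ℕ => (by positivity : 0 < t / ((m : ℝ≥0) + 1)))
      (tendsto_meshSize t) ht
    refine tendsto_nhds_unique ?_ (((continuous_integral_jumpPath hN hU hUu hL ρ).tendsto t).comp
      (hs.mono_right nhdsWithin_le_nhds))
    refine tendsto_integral_of_dominated_convergence (fun _ => ‖ρ‖)
      (fun m => ((stronglyMeasurable_jumpPath hN hU L ρ _).mono (ℱ.le _)).aestronglyMeasurable)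
      (integrable_const _)
      (fun m => Eventually.of_forall fun ω => norm_jumpPath_le hUu hL ρ _)
      (Eventually.of_forall fun ω => ?_)
    have h1 := tendsto_jumpPath_left (hN.isCountingPath ω) hU L ρ t
    rw [leftLim_jumpPath (hN.isCountingPath ω) hU]
    exact h1.comp hs

end JumpMean

/-! ### Self-consistent means and existence. -/

section Existence

variable {d : ℕ}

/-- Exchanging the summation indices absorbs both the conjugation of the kernel and that of `ρ`.
This makes the Hamiltonian self-adjoint and its propagator unitary. -/
lemma IsPairInteraction.star_meanFieldOp {a : Matrix (Fin d × Fin d) (Fin d × Fin d) ℂ}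
    (ha : IsPairInteraction a) {ρ : Matrix (Fin d) (Fin d) ℂ} (hρ : star ρ = ρ) :
    star (meanFieldOp a ρ) = meanFieldOp a ρ := by
  ext x x'
  have hρ' : ∀ y y', star (ρ y y') = ρ y' y := fun y y' => by
    conv_rhs => rw [← hρ]
    rw [Matrix.star_apply]
  rw [Matrix.star_apply]
  simp only [meanFieldOp, Matrix.of_apply, star_sum, star_mul', star_star]
  rw [Finset.sum_comm]
  refine Finset.sum_congr rfl fun y _ => Finset.sum_congr rfl fun y' _ => ?_
  rw [← ha.selfAdjoint, hρ']

/-- A family of candidate means of the particles: self-adjoint, bounded by `R`, continuous in time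
and measurable in the label of the particle. -/
structure IsMeanFamily (R : ℝ) (m : unitInterval × ℝ≥0 → Matrix (Fin d) (Fin d) ℂ) : Prop where
  star_eq : ∀ i, star (m i) = m i
  norm_le : ∀ i, ‖m i‖ ≤ R
  continuous : ∀ v, Continuous fun t => m (v, t)
  stronglyMeasurable : ∀ t, StronglyMeasurable fun v => m (v, t)

/-- The Hamiltonian `H + ∫₀¹ W(u,v) A^{m^v_t} dv` generated by a family of means. -/
noncomputable def meanHamiltonian (H : Matrix (Fin d) (Fin d) ℂ)
    (a : Matrix (Fin d × Fin d) (Fin d × Fin d) ℂ) (W : unitInterval → unitInterval → ℝ)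
    (m : unitInterval × ℝ≥0 → Matrix (Fin d) (Fin d) ℂ) (u : unitInterval) (t : ℝ) :
    Matrix (Fin d) (Fin d) ℂ :=
  H + ∫ v : unitInterval, W u v • meanFieldOp a (m (v, t.toNNReal))

variable {H : Matrix (Fin d) (Fin d) ℂ} {a : Matrix (Fin d × Fin d) (Fin d × Fin d) ℂ}
  {W : unitInterval → unitInterval → ℝ} {R : ℝ}
  {m m' : unitInterval × ℝ≥0 → Matrix (Fin d) (Fin d) ℂ}

lemma IsGraphon.norm_smul_meanFieldOp_le (hW : IsGraphon W)
    (a : Matrix (Fin d × Fin d) (Fin d × Fin d) ℂ) {ρ : Matrix (Fin d) (Fin d) ℂ} {b : ℝ}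
    (hρ : ‖ρ‖ ≤ b) (u v : unitInterval) :
    ‖W u v • meanFieldOp a ρ‖ ≤ ‖meanFieldCLM a‖ * b := by
  rw [norm_smul, Real.norm_of_nonneg (hW.mem_Icc u v).1, ← meanFieldCLM_apply]
  calc W u v * ‖meanFieldCLM a ρ‖ ≤ 1 * (‖meanFieldCLM a‖ * b) := by
        refine mul_le_mul (hW.mem_Icc u v).2 ?_ (norm_nonneg _) zero_le_one
        exact (meanFieldCLM a).le_of_opNorm_le_of_le le_rfl hρ
    _ = _ := one_mul _

namespace IsMeanFamily

lemma integrable (hm : IsMeanFamily R m) (t : ℝ≥0) :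
    Integrable fun v : unitInterval => m (v, t) :=
  Integrable.of_bound (hm.stronglyMeasurable t).aestronglyMeasurable R
    (Eventually.of_forall fun _ => hm.norm_le _)

lemma star_meanHamiltonian (hm : IsMeanFamily R m) (hH : H.IsHermitian)
    (ha : IsPairInteraction a) (u : unitInterval) (t : ℝ) :
    star (meanHamiltonian H a W m u t) = meanHamiltonian H a W m u t := by
  unfold meanHamiltonian
  have := (starL' ℝ (A := Matrix (Fin d) (Fin d) ℂ)).integral_comp_comm
    (μ := (volume : Measure unitInterval))
    (fun v : unitInterval => W u v • meanFieldOp a (m (v, t.toNNReal)))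
  simp only [starL'_apply] at this
  rw [star_add, ← this, show star H = H from hH]
  congr 2
  funext v
  rw [star_smul, star_trivial, ha.star_meanFieldOp (hm.star_eq _)]

lemma norm_meanHamiltonian_le (hm : IsMeanFamily R m) (hW : IsGraphon W) (u : unitInterval)
    (t : ℝ) : ‖meanHamiltonian H a W m u t‖ ≤ ‖H‖ + ‖meanFieldCLM a‖ * R := by
  refine (norm_add_le _ _).trans (add_le_add le_rfl ?_)
  refine (norm_integral_le_of_norm_le_const (Eventually.of_forall fun v =>
    hW.norm_smul_meanFieldOp_le a (hm.norm_le _) u v)).trans (le_of_eq ?_)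
  simp

lemma norm_meanHamiltonian_sub_le (hm : IsMeanFamily R m) (hm' : IsMeanFamily R m')
    (hW : IsGraphon W) {t b : ℝ} (hb : ∀ v, ‖m (v, t.toNNReal) - m' (v, t.toNNReal)‖ ≤ b)
    (u : unitInterval) :
    ‖meanHamiltonian H a W m u t - meanHamiltonian H a W m' u t‖ ≤ ‖meanFieldCLM a‖ * b := by
  unfold meanHamiltonian
  rw [add_sub_add_left_eq_sub, ← integral_sub (hW.integrable_smul a (hm.integrable _) u)
    (hW.integrable_smul a (hm'.integrable _) u)]
  refine (norm_integral_le_of_norm_le_const (C := ‖meanFieldCLM a‖ * b)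
    (Eventually.of_forall fun v => ?_)).trans (le_of_eq (by simp))
  have := hW.norm_smul_meanFieldOp_le a (hb v) u v
  rwa [← meanFieldCLM_apply, map_sub, smul_sub] at this

/-- Dominated convergence in `v`. Negative times are frozen at `0` by `toNNReal`, so continuity
holds on all of `ℝ`, where the propagator is built. -/
lemma continuous_meanHamiltonian (hm : IsMeanFamily R m) (hW : IsGraphon W) (u : unitInterval) :
    Continuous (meanHamiltonian H a W m u) := by
  refine continuous_const.add (continuous_of_dominated (bound := fun _ => ‖meanFieldCLM a‖ * R)
    (fun t => ?_) (fun t => Eventually.of_forall fun v =>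
      hW.norm_smul_meanFieldOp_le a (hm.norm_le _) u v) (integrable_const _)
    (Eventually.of_forall fun v => ?_))
  · exact (hW.integrable_smul a (hm.integrable _) u).aestronglyMeasurable
  · exact ((meanFieldCLM a).continuous.comp
      ((hm.continuous v).comp continuous_real_toNNReal)).const_smul (W u v)

lemma stronglyMeasurable_meanHamiltonian (hm : IsMeanFamily R m) (hW : IsGraphon W) (t : ℝ) :
    StronglyMeasurable fun u => meanHamiltonian H a W m u t := by
  refine stronglyMeasurable_const.add (StronglyMeasurable.integral_prod_right'
    (f := fun q : unitInterval × unitInterval => W q.1 q.2 • meanFieldOp a (m (q.2, t.toNNReal)))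
    ?_)
  refine StronglyMeasurable.smul (f := fun q : unitInterval × unitInterval => W q.1 q.2)
    hW.measurable.stronglyMeasurable ?_
  exact (meanFieldCLM a).continuous.comp_stronglyMeasurable
    ((hm.stronglyMeasurable t.toNNReal).comp_measurable measurable_snd)

lemma of_weighted_approx {x : ℕ → unitInterval × ℝ≥0 → Matrix (Fin d) (Fin d) ℂ} {D l : ℝ}
    (hx : ∀ n, IsMeanFamily R (x n))
    (h : ∀ n i, ‖x n i - m i‖ ≤ D * (1 / 2) ^ n * Real.exp (l * i.2)) : IsMeanFamily R m := by
  have hlim : ∀ i, Tendsto (fun n => x n i) atTop (𝓝 (m i)) := fun i =>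
    tendsto_of_weighted_approx fun n => h n i
  refine ⟨fun i => ?_, fun i => ?_, fun v => ?_, fun t => ?_⟩
  · refine tendsto_nhds_unique ((hlim i).star.congr fun n => (hx n).star_eq i) (hlim i)
  · exact le_of_tendsto' (hlim i).norm fun n => (hx n).norm_le i
  · exact continuous_of_weighted_approx (w := fun t : ℝ≥0 => Real.exp (l * t))
      (fun n => (hx n).continuous v) (by fun_prop) (fun t => (Real.exp_pos _).le)
      (fun n t => h n (v, t))
  · exact stronglyMeasurable_of_tendsto atTop (fun n => (hx n).stronglyMeasurable t)
      (tendsto_pi_nhds.2 fun v => hlim (v, t))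

end IsMeanFamily

/-- `U` is a family of propagators of the Hamiltonians `h`. -/
structure IsUnitaryPropagator (h : unitInterval → ℝ → Matrix (Fin d) (Fin d) ℂ)
    (U : unitInterval → ℝ → Matrix (Fin d) (Fin d) ℂ) : Prop where
  hasDerivAt : ∀ u t, HasDerivAt (U u) (-Complex.I • h u t * U u t) t
  zero : ∀ u, U u 0 = 1
  mem_unitary : ∀ u t, U u t ∈ unitary (Matrix (Fin d) (Fin d) ℂ)
  stronglyMeasurable : ∀ t, StronglyMeasurable fun u => U u t

lemma IsUnitaryPropagator.continuous {h U : unitInterval → ℝ → Matrix (Fin d) (Fin d) ℂ}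
    (hU : IsUnitaryPropagator h U) (u : unitInterval) : Continuous (U u) :=
  continuous_iff_continuousAt.2 fun t => (hU.hasDerivAt u t).continuousAt

lemma IsMeanFamily.exists_propagator (hm : IsMeanFamily R m) (hH : H.IsHermitian)
    (ha : IsPairInteraction a) (hW : IsGraphon W) :
    ∃ U, IsUnitaryPropagator (meanHamiltonian H a W m) U := by
  obtain ⟨U, h1, h2, h3⟩ := _root_.exists_propagator
    (fun u t => -Complex.I • meanHamiltonian H a W m u t)
    (fun u => (hm.continuous_meanHamiltonian hW u).const_smul (-Complex.I))
    (fun t => (hm.stronglyMeasurable_meanHamiltonian hW t).const_smul (-Complex.I))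
    (K := ‖H‖ + ‖meanFieldCLM a‖ * R) (fun u t => by
      rw [norm_smul, norm_neg, Complex.norm_I, one_mul]
      exact hm.norm_meanHamiltonian_le hW u t)
  refine ⟨U, h1, h2, fun u t => ?_, h3⟩
  refine propagator_mem_unitary (h1 u) (h2 u) (fun t => ?_) (fun x y h => mul_eq_one_comm.1 h) t
  rw [star_smul, hm.star_meanHamiltonian hH ha]
  simp

variable {Ω : Type*} {mΩ : MeasurableSpace Ω} {P : Measure Ω} [IsProbabilityMeasure P]
  {ℱ : Filtration ℝ≥0 mΩ} {N : unitInterval → ℝ≥0 → Ω → ℕ}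
  {L ρ₀ : Matrix (Fin d) (Fin d) ℂ}

lemma isMeanFamily_integral_jumpPath {h U : unitInterval → ℝ → Matrix (Fin d) (Fin d) ℂ}
    (hN : ∀ u, IsUnitPoissonProcess P ℱ (N u)) (hU : IsUnitaryPropagator h U)
    (hL : L ∈ unitary (Matrix (Fin d) (Fin d) ℂ)) (hρ : star ρ₀ = ρ₀) :
    IsMeanFamily ‖ρ₀‖ fun i => ∫ ω, jumpPath (N i.1 · ω) (U i.1) L ρ₀ i.2 ∂P := by
  refine ⟨fun i => ?_, fun i => ?_, fun v => ?_, fun t => ?_⟩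
  · have := (starL' ℝ (A := Matrix (Fin d) (Fin d) ℂ)).integral_comp_comm (μ := P)
      (fun ω => jumpPath (N i.1 · ω) (U i.1) L ρ₀ i.2)
    simp only [starL'_apply] at this
    rw [← this]
    simp_rw [star_jumpPath hρ]
  · refine (norm_integral_le_of_norm_le_const (Eventually.of_forall fun ω =>
      norm_jumpPath_le (hU.mem_unitary i.1) hL ρ₀ i.2)).trans (le_of_eq (by simp))
  · exact continuous_integral_jumpPath (hN v) (hU.continuous v) (hU.mem_unitary v) hL ρ₀
  · exact stronglyMeasurable_integral_jumpPath hN hU.continuous hU.mem_unitary hU.zero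
      hU.stronglyMeasurable hL ρ₀ t

/-- The means of two paths with different mean fields. -/
lemma norm_integral_jumpPath_sub_le {U U' : unitInterval → ℝ → Matrix (Fin d) (Fin d) ℂ}
    (hN : ∀ u, IsUnitPoissonProcess P ℱ (N u)) (hm : IsMeanFamily R m)
    (hm' : IsMeanFamily R m') (hU : IsUnitaryPropagator (meanHamiltonian H a W m) U)
    (hU' : IsUnitaryPropagator (meanHamiltonian H a W m') U') (hH : H.IsHermitian)
    (ha : IsPairInteraction a) (hW : IsGraphon W)
    (hL : L ∈ unitary (Matrix (Fin d) (Fin d) ℂ)) {D l : ℝ} (hD : 0 ≤ D) (hl : 0 < l)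
    (hb : ∀ i, ‖m i - m' i‖ ≤ D * Real.exp (l * i.2)) (u : unitInterval) (t : ℝ≥0) :
    ‖(∫ ω, jumpPath (N u · ω) (U u) L ρ₀ t ∂P) - ∫ ω, jumpPath (N u · ω) (U' u) L ρ₀ t ∂P‖
      ≤ 2 * ‖ρ₀‖ * (‖meanFieldCLM a‖ * D * (Real.exp (l * t) / l)) := by
  rw [← integral_sub (integrable_jumpPath (hN u) (hU.continuous u) (hU.mem_unitary u) hL ρ₀ t)
    (integrable_jumpPath (hN u) (hU'.continuous u) (hU'.mem_unitary u) hL ρ₀ t)]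
  -- Both paths are driven by the same `N u`, so the estimate holds for every `ω` before averaging.
  have hpath : ∀ ω, ‖jumpPath (N u · ω) (U u) L ρ₀ t - jumpPath (N u · ω) (U' u) L ρ₀ t‖
      ≤ 2 * ‖ρ₀‖ * (‖meanFieldCLM a‖ * D * (Real.exp (l * t) / l)) := by
    intro ω
    refine (norm_conj_sub_conj_le (jumpFlow_mem (hU.mem_unitary u) hL _ _)
      (jumpFlow_mem (hU'.mem_unitary u) hL _ _) ρ₀).trans ?_
    gcongr
    refine (norm_jumpFlow_sub_le ((hN u).isCountingPath ω) (hU.hasDerivAt u) (hU'.hasDerivAt u)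
      (hm.star_meanHamiltonian hH ha u) (hm.continuous_meanHamiltonian hW u)
      (hm'.continuous_meanHamiltonian hW u) (hU.mem_unitary u) (hU'.mem_unitary u) hL
      (hU.zero u) (hU'.zero u)
      (φ := fun s => ‖meanFieldCLM a‖ * D * Real.exp (l * s)) (by fun_prop) (fun s hs => ?_) _ t
      le_rfl).trans ?_
    · rw [mul_assoc]
      refine hm.norm_meanHamiltonian_sub_le hm' hW (fun v => ?_) u
      have := hb (v, s.toNNReal)
      rwa [Real.coe_toNNReal s hs] at this
    · rw [intervalIntegral.integral_const_mul]
      have := integral_exp_mul_le hl t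
      gcongr
  exact (norm_integral_le_of_norm_le_const (Eventually.of_forall hpath)).trans
    (le_of_eq (by simp))

/-- The self-consistent family of means. -/
theorem exists_mean_fixedPoint (hN : ∀ u, IsUnitPoissonProcess P ℱ (N u)) (hH : H.IsHermitian)
    (ha : IsPairInteraction a) (hW : IsGraphon W)
    (hL : L ∈ unitary (Matrix (Fin d) (Fin d) ℂ)) (hρ : star ρ₀ = ρ₀) :
    ∃ m U, IsMeanFamily ‖ρ₀‖ m ∧ IsUnitaryPropagator (meanHamiltonian H a W m) U ∧
      ∀ u t, ∫ ω, jumpPath (N u · ω) (U u) L ρ₀ t ∂P = m (u, t) := by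
  choose! U hU using fun (m : unitInterval × ℝ≥0 → Matrix (Fin d) (Fin d) ℂ)
    (hm : IsMeanFamily ‖ρ₀‖ m) => hm.exists_propagator (W := W) (H := H) hH ha hW
  -- The contraction factor is `2 ‖ρ₀‖ ‖meanFieldCLM a‖ / l`, which this choice makes at most `1 /
  -- 2`.
  set l : ℝ := 4 * ‖ρ₀‖ * ‖meanFieldCLM a‖ + 1 with hl
  have hl0 : 0 < l := by positivity
  obtain ⟨m, hm, hfix⟩ := exists_fixedPoint_of_weighted_contraction
    (fun i : unitInterval × ℝ≥0 => Real.exp (l * i.2)) (IsMeanFamily ‖ρ₀‖)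
    (fun m i => ∫ ω, jumpPath (N i.1 · ω) (U m i.1) L ρ₀ i.2 ∂P)
    (fun m hm => isMeanFamily_integral_jumpPath hN (hU m hm) hL hρ)
    (fun x y D hx h => IsMeanFamily.of_weighted_approx hx h)
    (fun x y hx hy D hD h i => by
      refine (norm_integral_jumpPath_sub_le hN hx hy (hU x hx) (hU y hy) hH ha hW hL hD hl0 h
        i.1 i.2).trans ?_
      have h1 : 2 * ‖ρ₀‖ * ‖meanFieldCLM a‖ / l ≤ 1 / 2 := by
        rw [div_le_div_iff₀ hl0 two_pos]; linarith
      calc _ = 2 * ‖ρ₀‖ * ‖meanFieldCLM a‖ / l * (D * Real.exp (l * i.2)) := by ring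
        _ ≤ 1 / 2 * (D * Real.exp (l * i.2)) := by gcongr
        _ = _ := by ring)
    (fun _ => ρ₀)
    ⟨fun _ => hρ, fun _ => le_rfl, fun _ => continuous_const, fun _ => stronglyMeasurable_const⟩
    (2 * ‖ρ₀‖) (by positivity) (fun i => by
      have hρ' : IsMeanFamily ‖ρ₀‖ fun _ => ρ₀ := ⟨fun _ => hρ, fun _ => le_rfl,
        fun _ => continuous_const, fun _ => stronglyMeasurable_const⟩
      have h1 := (isMeanFamily_integral_jumpPath hN (hU _ hρ') hL hρ).norm_le i
      have h2 : 1 ≤ Real.exp (l * i.2) := Real.one_le_exp (by positivity)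
      refine (norm_sub_le _ _).trans ?_
      refine le_trans ?_ (le_mul_of_one_le_right (by positivity) h2)
      linarith)
  exact ⟨m, U m, hm, hU m hm, fun u t => congrFun hfix (u, t)⟩

/-- Existence of a solution with values in the density matrices. -/
theorem exists_isJumpGraphonSolution (hN : ∀ u, IsUnitPoissonProcess P ℱ (N u))
    (hH : H.IsHermitian) (ha : IsPairInteraction a) (hW : IsGraphon W)
    (hL : L ∈ Matrix.unitaryGroup (Fin d) ℂ) (hρ₀ : ρ₀ ∈ densityMatrices d) (T : ℝ≥0) :
    ∃ γ, IsJumpGraphonSolution P ℱ N H L a W ρ₀ T γ ∧ ∀ u t ω, γ u t ω ∈ densityMatrices d := by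
  have hL' : L ∈ unitary (Matrix (Fin d) (Fin d) ℂ) := hL
  have hρ : star ρ₀ = ρ₀ := hρ₀.1.isHermitian
  obtain ⟨m, U, hm, hU, hmean⟩ := exists_mean_fixedPoint hN hH ha hW hL' hρ
  set γ : unitInterval → ℝ≥0 → Ω → Matrix (Fin d) (Fin d) ℂ :=
    fun u t ω => jumpPath (N u · ω) (U u) L ρ₀ t with hγ
  have hn := fun u ω => (hN u).isCountingPath ω
  have hleft : ∀ u t ω, leftProcess (γ u) t ω
      = jumpState (N u · ω) (U u) L ρ₀ (Function.leftLim (N u · ω) t) t := fun u t ω =>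
    leftLim_jumpPath (hn u ω) (hU.continuous u) L ρ₀ t
  have hmean' : ∀ v t, ∫ ω, leftProcess (γ v) t ω ∂P = m (v, t) := fun v t =>
    (integral_leftLim_jumpPath (hN v) (hU.continuous v) (hU.mem_unitary v) hL' ρ₀ t).trans
      (hmean v t)
  -- This is where the fixed point is used: the Hamiltonian generated by the paths themselves is the
  -- one that produced them.
  have hham : ∀ u (t : ℝ≥0), effectiveHamiltonian P H a W γ u t = meanHamiltonian H a W m u t := by
    intro u t
    simp only [effectiveHamiltonian, meanHamiltonian, hmean', Real.toNNReal_coe]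
  have hdrift : ∀ u ω (s : ℝ≥0), jumpDrift P H a W γ u (s : ℝ).toNNReal ω
      = -Complex.I • (meanHamiltonian H a W m u s
        * jumpState (N u · ω) (U u) L ρ₀ (Function.leftLim (N u · ω) s) s
        - jumpState (N u · ω) (U u) L ρ₀ (Function.leftLim (N u · ω) s) s
        * meanHamiltonian H a W m u s) := by
    intro u ω s
    simp only [jumpDrift, hham, hleft, Real.toNNReal_coe]
  have hsolve := fun u ω t => jumpState_eq_integral_add_sum (hn u ω) (hU.hasDerivAt u)
    (hm.star_meanHamiltonian hH ha u) (hm.continuous_meanHamiltonian hW u) (hU.mem_unitary u)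
    (hU.zero u) L ρ₀ (F := fun s => jumpDrift P H a W γ u s.toNNReal ω) (hdrift u ω) (N u t ω) t le_rfl ((hn u ω).monotone.leftLim_le le_rfl)
  refine ⟨γ, ⟨fun u t _ => ?_, fun u => ?_, ?_, fun t _ => ?_, fun u => ?_, fun u => ?_⟩,
    fun u t ω => ?_⟩
  · exact stronglyMeasurable_jumpPath (hN u) (hU.continuous u) L ρ₀ t
  · exact Eventually.of_forall fun ω => isCadlagOn_jumpPath (hn u ω) (hU.continuous u) L ρ₀ T
  · refine ⟨‖ρ₀‖₊, fun u t _ => ?_⟩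
    refine (lintegral_mono (g := fun _ => (‖ρ₀‖₊ : ℝ≥0∞)) fun ω => ?_).trans (by simp)
    exact enorm_le_iff_norm_le.2 (norm_jumpPath_le (hU.mem_unitary u) hL' ρ₀ t)
  · simp_rw [hmean']
    exact hm.integrable t
  · exact Eventually.of_forall fun ω => (hsolve u ω T).1
  · filter_upwards [(hN u).ae_jumpTime_lt T] with ω hsimple t ht
    rw [(hn u ω).countingIntegral_eq_sum]
    refine (hsolve u ω t).2.trans (congrArg _ (Finset.sum_congr rfl fun j hj => ?_))
    have hj := Finset.mem_range.1 hj
    -- Simplicity of the jumps: just before the `j`-th jump time exactly `j` jumps have occurred, so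
    -- the state reached after `j` jumps is the left limit required by the equation.
    have hlj : Function.leftLim (N u · ω) (jumpTime (N u · ω) j) = j := by
      have h1 := (((hn u ω).jumpTime_eq_iff hj _).1 rfl).1
      refine le_antisymm h1 ?_
      rcases j with _ | i
      · exact Nat.zero_le _
      · have hiT : i + 1 < N u T ω := lt_of_lt_of_le hj ((hn u ω).monotone ht)
        exact ((hn u ω).lt_leftLim_iff_jumpTime_lt (Nat.lt_of_succ_lt hj) _).2 (hsimple i hiT)
    rw [hleft, hlj, Matrix.star_eq_conjTranspose]
  · have hV : jumpFlow (N u · ω) (U u) L (N u t ω) t ∈ unitary (Matrix (Fin d) (Fin d) ℂ) :=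
      jumpFlow_mem (hU.mem_unitary u) hL' _ _
    refine ⟨hρ₀.1.mul_mul_conjTranspose_same _, ?_⟩
    change (jumpFlow (N u · ω) (U u) L (N u t ω) t * ρ₀
      * star (jumpFlow (N u · ω) (U u) L (N u t ω) t)).trace = 1
    rw [Matrix.trace_mul_comm, ← mul_assoc, hV.1, one_mul, hρ₀.2]

end Existence

theorem mainTheorem2 {d : ℕ} {Ω : Type*} {mΩ : MeasurableSpace Ω}
    (P : Measure Ω) [IsProbabilityMeasure P] (ℱ : Filtration ℝ≥0 mΩ)
    (N : unitInterval → ℝ≥0 → Ω → ℕ) (hN : ∀ u, IsUnitPoissonProcess P ℱ (N u))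
    (H L : Matrix (Fin d) (Fin d) ℂ) (hH : H.IsHermitian)
    (hL : L ∈ Matrix.unitaryGroup (Fin d) ℂ)
    (a : Matrix (Fin d × Fin d) (Fin d × Fin d) ℂ) (ha : IsPairInteraction a)
    (W : unitInterval → unitInterval → ℝ) (hW : IsGraphon W)
    (ρ₀ : Matrix (Fin d) (Fin d) ℂ) (hρ₀ : ρ₀ ∈ densityMatrices d)
    (T : ℝ≥0) (hT : 0 < T) :
    (∃ γ, IsJumpGraphonSolution P ℱ N H L a W ρ₀ T γ) ∧
    (∀ γ γ', IsJumpGraphonSolution P ℱ N H L a W ρ₀ T γ →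
      IsJumpGraphonSolution P ℱ N H L a W ρ₀ T γ' →
      ∀ u, ∀ᵐ ω ∂P, ∀ t ≤ T, γ u t ω = γ' u t ω) ∧
    (∀ γ, IsJumpGraphonSolution P ℱ N H L a W ρ₀ T γ →
      ∀ u, ∀ᵐ ω ∂P, ∀ t ≤ T, γ u t ω ∈ densityMatrices d) := by
  obtain ⟨γ₀, h₀, hd⟩ := exists_isJumpGraphonSolution hN hH ha hW hL hρ₀ T
  refine ⟨⟨γ₀, h₀⟩, fun γ γ' h h' u => h.ae_eq h' hN hW u, fun γ h u => ?_⟩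
  filter_upwards [h.ae_eq h₀ hN hW u] with ω hω t ht
  rw [hω t ht]
  exact hd u t ω
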